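/- **Theorem 4.** Let $b,\mu>0$, $\omega\in\mathbb R$ with $\omega^2>2\mu^2$, and let $f=\dfrac{b\mu^3}{\omega^2-2\mu^2}$. Consider an open ($k=-1$) FLRW universe with scale factor $a$, Hubble parameter $H=\dot a/a>0$, a perfect fluid with $p_m=(\gamma-1)\rho_m$, $\rho_m\ge 0$, and a scalar field $\phi$ with potential $V(\phi)=\mu^3\big[bf(1-\cos(\phi/f))+\phi^2/\mu\big]$. Put $$\Omega=\sqrt{\frac{\omega^2\phi^2+\dot\phi^2}{6H^2}}>0,\qquad \Omega_k=\frac1{a^2H^2}>0,\qquad \Phi=t\omega-\tan^{-1}\frac{\omega\phi}{\dot\phi},\qquad \theta=t\omega-\Phi ,$$ so that $\phi=\sqrt6\,H\Omega\sin\theta/\omega$, $\dot\phi=\sqrt6\,H\Omega\cos\theta$, and $\Omega_m=\rho_m/(3H^2)=1-\Omega_k-\Omega^2\cos^2\theta-V(\phi)/(3H^2)\ge0$. The *full system* consists of $$\begin{aligned} \dot\Omega={}&-\tfrac{b\gamma f\mu^3\Omega}{H}\sin^2\!\Big(\tfrac{\sqrt{3/2}\,H\Omega\sin\theta}{f\omega}\Big)-\tfrac{b\mu^3}{\sqrt6H}\cos\theta\,\sin\!\Big(\tfrac{\sqrt6H\Omega\sin\theta}{f\omega}\Big)+H\cos^2\theta\Big(\Omega^3\big(\gamma(\tfrac{3\mu^2}{\omega^2}-\tfrac32)+3\big)-3\Omega\Big)\\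 &+\tfrac12H\Omega\Big(3\gamma-\tfrac{6\gamma\mu^2\Omega^2}{\omega^2}+(2-3\gamma)\Omega_k\Big)+\tfrac{(\omega^2-2\mu^2)\Omega}{2\omega}\sin2\theta,\\ \dot\Omega_k={}&\tfrac{b\gamma f\mu^3\Omega_k}{H}\Big(-1+\cos\tfrac{\sqrt6H\Omega\sin\theta}{f\omega}\Big)-H\Omega_k\Big(\tfrac{6\gamma\mu^2\Omega^2\sin^2\theta}{\omega^2}+(3\gamma-2)(\Omega_k-1)\Big)-3(\gamma-2)H\Omega^2\Omega_k\cos^2\theta,\\ \dot\Phi={}&-3H\sin\theta\cos\theta+\tfrac{\omega^2-2\mu^2}{\omega}\sin^2\theta-\tfrac{b\mu^3}{\sqrt6H\Omega}\sin\theta\,\sin\!\Big(\tfrac{\sqrt6H\Omega\sin\theta}{f\omega}\Big),\qquad \dot H=-(1+q)H^2,\\ q={}&-1+\tfrac{3\gamma}2-\tfrac{3\gamma\mu^2\Omega^2\sin^2\theta}{\omega^2}-\tfrac32(\gamma-2)\Omega^2\cos^2\theta-\tfrac32\gamma\Omega_k+\Omega_k-\tfrac{b\gamma f\mu^3}{H^2}\sin^2\!\Big(\tfrac{\sqrt{3/2}\,H\Omega\sin\theta}{f\omega}\Big),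 \end{aligned}$$ and the *averaged system*, in $\tau=\log a$ and on the phase space $\{\Omega^2+\Omega_k\le1,\ \Omega_k\ge0\}$, $H>0$, of $$\begin{aligned} &\tfrac{d\Omega}{d\tau}=-\tfrac12\Omega\big(3(\gamma-1)(\Omega^2-1)+(3\gamma-2)\Omega_k\big),\qquad \tfrac{d\Omega_k}{d\tau}=-\Omega_k\big(3(\gamma-1)\Omega^2-3\gamma+(3\gamma-2)\Omega_k+2\big),\\ &\tfrac{d\Phi}{d\tau}=0,\qquad \tfrac{dH}{d\tau}=-(1+q)H,\quad 1+q=\tfrac12\big(3\gamma(1-\Omega_k-\Omega^2)+3\Omega^2+2\Omega_k\big),\qquad \tfrac{dt}{d\tau}=\tfrac1H, \end{aligned}$$ with $\Omega_m=1-\Omega^2-\Omega_k$. Let $F_0:(\Omega,\Omega_k)=(0,0)$ and $C:(\Omega,\Omega_k)=(0,1)$. "$p$ is stable" means Lyapunov stable in the variables $(\Omega,\Omega_k)$ relative to the phase space; for the full system it means that there is $h>0$ such that this holds uniformly in the initial time and in the other initial data, for all solutions with initial value of $H$ at most $h$. "A solution has the late-time limit $p$ with deceleration $q_\infty$ and line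 element $-dt^2+a_0^2s_{H_0}(t)^2(dr^2+\sinh^2 r\,d\Omega^2)$" means: $(\Omega,\Omega_k)\to p$, $t\to\infty$, $H\to0$, $q\to q_\infty$, $tH\to1/(1+q_\infty)$, and $a(t)/(a_0s_{H_0}(t))\to1$ for some $a_0,H_0>0$. Below, $h>0$ depends only on $\gamma,\mu,b,\omega$, and solutions are those that exist for all later times. (i) Let $0<\gamma\le\frac23$. The averaged system resting at $F_0$ with $H=H_0$ and $a=a_0$ at $t=0$ has exactly the line element of the matter dominated FLRW universe, $$ds^2=-dt^2+a_0^2\Big(\tfrac{3\gamma H_0t}{2}+1\Big)^{\frac4{3\gamma}}\big(dr^2+\sinh^2r\,d\Omega^2\big),$$ and $F_0$ is stable for the averaged system and for the full system. If $\gamma<\frac23$ (quintessence), $F_0$ is the late-time attractor: every solution of the averaged system with $\Omega_m>0$ initially, and every solution of the full system with $\Omega_m>0$ and $H\le h$ initially, has the late-time limit $F_0$, with deceleration $\frac{3\gamma-2}2<0$ and the above line element. If $\gamma=\frac23$ (zero acceleration), $F_0$ belongs to the line $\Omega=0$ of equilibrium points, all with the same line element as $F_0$, and this line is the attractor: every solution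 of the averaged system with $\Omega_k+\Omega_m>0$ initially, and every solution of the full system with $H\le h$ initially, has the late-time limit $\big(0,\ \frac{\Omega_k}{\Omega_k+\Omega_m}\big|_{\text{initial}}\big)$, with deceleration $0$ and the above line element with $\gamma=\frac23$. As $\gamma\to0^+$ with $H_0>0$ and $t$ fixed, $\big(\frac{3\gamma H_0t}2+1\big)^{2/(3\gamma)}\to e^{H_0t}$ (de Sitter). (ii) Let $\frac23<\gamma<2$. The averaged system resting at $C$ with $H=H_0$ and $a=a_0$ at $t=0$ has exactly the line element of the Milne solution, $ds^2=-dt^2+a_0^2(H_0t+1)^2(dr^2+\sinh^2r\,d\Omega^2)$; $C$ is stable for the averaged system and for the full system; and $C$ is the late-time attractor: every solution of the averaged system with $\Omega_k>0$ initially, and every solution of the full system with $H\le h$ initially, has the late-time limit $C$ (so $\Omega_k\to1$), with deceleration $0$ and the Milne line element. -/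

import Mathlib

open Filter Topology Set

noncomputable section

namespace OpenFLRW

/-- Parameters of the model: the barotropic index `γ` of the fluid (`p = (γ - 1) ρ`), the parameters
`μ`, `b` of the potential, and the angular frequency `ω`. -/
structure Params where
  γ : ℝ
  μ : ℝ
  b : ℝ
  ω : ℝ

/-- The third parameter `f` of the potential, fixed by `b μ³ + 2 f μ² - f ω² = 0`. -/
def Params.f (P : Params) : ℝ := P.b * P.μ ^ 3 / (P.ω ^ 2 - 2 * P.μ ^ 2)

/-- The generalized harmonic potential
`V(φ) = μ³ [b f (1 - cos (φ / f)) + φ² / μ]`. -/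
def Params.V (P : Params) (φ : ℝ) : ℝ :=
  P.μ ^ 3 * (P.b * P.f * (1 - Real.cos (φ / P.f)) + φ ^ 2 / P.μ)

/-! ### The full system -/

/-- A state of the full system: `Ω = √((ω² φ² + φ'²) / (6 H²))`, `Ωk = 1 / (a² H²)`,
`Φ = t ω - arctan (ω φ / φ')`, and the Hubble parameter `H`.  In terms of these,
`φ = √6 H Ω sin (t ω - Φ) / ω` and `φ' = √6 H Ω cos (t ω - Φ)`. -/
structure FullState where
  Ω : ℝ
  Ωk : ℝ
  Φ : ℝ
  H : ℝ

namespace FullState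

/-- The pair of variables in which the equilibrium points are given. -/
def point (s : FullState) : ℝ × ℝ := (s.Ω, s.Ωk)

/-- The phase `θ = t ω - Φ`. -/
def θ (P : Params) (t : ℝ) (s : FullState) : ℝ := t * P.ω - s.Φ

/-- The scalar field `φ` at time `t`. -/
def φ (P : Params) (t : ℝ) (s : FullState) : ℝ :=
  √6 * s.H * s.Ω * Real.sin (s.θ P t) / P.ω

/-- The matter density fraction `Ω_m = ρ_m / (3 H²)`, given by the Friedmann constraint
`3 H² = ρ_m + φ'² / 2 + V(φ) + 3 / a²`. -/
def Ωm (P : Params) (t : ℝ) (s : FullState) : ℝ :=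
  1 - s.Ωk - s.Ω ^ 2 * Real.cos (s.θ P t) ^ 2 - P.V (s.φ P t) / (3 * s.H ^ 2)

/-- The scale factor, from `Ωk = 1 / (a² H²)`. -/
def scaleFactor (s : FullState) : ℝ := 1 / (s.H * √s.Ωk)

/-- The deceleration parameter of the full system. -/
def q (P : Params) (t : ℝ) (s : FullState) : ℝ :=
  -1 + 3 * P.γ / 2 - 3 * P.γ * P.μ ^ 2 * s.Ω ^ 2 * Real.sin (s.θ P t) ^ 2 / P.ω ^ 2
    - 3 / 2 * (P.γ - 2) * s.Ω ^ 2 * Real.cos (s.θ P t) ^ 2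
    - 3 / 2 * P.γ * s.Ωk + s.Ωk
    - P.b * P.γ * P.f * P.μ ^ 3 / s.H ^ 2
      * Real.sin (√(3 / 2) * s.H * s.Ω * Real.sin (s.θ P t) / (P.f * P.ω)) ^ 2

/-- Right-hand side of the equation for `Ω`. -/
def dΩ (P : Params) (t : ℝ) (s : FullState) : ℝ :=
  -(P.b * P.γ * P.f * P.μ ^ 3 * s.Ω / s.H
      * Real.sin (√(3 / 2) * s.H * s.Ω * Real.sin (s.θ P t) / (P.f * P.ω)) ^ 2)
    - P.b * P.μ ^ 3 / (√6 * s.H) * Real.cos (s.θ P t)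
      * Real.sin (√6 * s.H * s.Ω * Real.sin (s.θ P t) / (P.f * P.ω))
    + s.H * Real.cos (s.θ P t) ^ 2
      * (s.Ω ^ 3 * (P.γ * (3 * P.μ ^ 2 / P.ω ^ 2 - 3 / 2) + 3) - 3 * s.Ω)
    + 1 / 2 * s.H * s.Ω
      * (3 * P.γ - 6 * P.γ * P.μ ^ 2 * s.Ω ^ 2 / P.ω ^ 2 + (2 - 3 * P.γ) * s.Ωk)
    + (P.ω ^ 2 - 2 * P.μ ^ 2) * s.Ω / (2 * P.ω) * Real.sin (2 * s.θ P t)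

/-- Right-hand side of the equation for `Ωk`. -/
def dΩk (P : Params) (t : ℝ) (s : FullState) : ℝ :=
  P.b * P.γ * P.f * P.μ ^ 3 * s.Ωk / s.H
      * (-1 + Real.cos (√6 * s.H * s.Ω * Real.sin (s.θ P t) / (P.f * P.ω)))
    - s.H * s.Ωk
      * (6 * P.γ * P.μ ^ 2 * s.Ω ^ 2 * Real.sin (s.θ P t) ^ 2 / P.ω ^ 2
        + (3 * P.γ - 2) * (s.Ωk - 1))
    - 3 * (P.γ - 2) * s.H * s.Ω ^ 2 * s.Ωk * Real.cos (s.θ P t) ^ 2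

/-- Right-hand side of the equation for `Φ`. -/
def dΦ (P : Params) (t : ℝ) (s : FullState) : ℝ :=
  -3 * s.H * Real.sin (s.θ P t) * Real.cos (s.θ P t)
    + (P.ω ^ 2 - 2 * P.μ ^ 2) / P.ω * Real.sin (s.θ P t) ^ 2
    - P.b * P.μ ^ 3 / (√6 * s.H * s.Ω) * Real.sin (s.θ P t)
      * Real.sin (√6 * s.H * s.Ω * Real.sin (s.θ P t) / (P.f * P.ω))

/-- Right-hand side of the Raychaudhuri equation for `H`. -/
def dH (P : Params) (t : ℝ) (s : FullState) : ℝ := -(1 + s.q P t) * s.H ^ 2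

/-- The physical phase space: expanding open models (`H > 0`, `Ωk > 0`) with a scalar field that is
not at rest in the origin (`Ω > 0`, so that `Φ` makes sense) and nonnegative matter density. -/
def Physical (P : Params) (t : ℝ) (s : FullState) : Prop :=
  0 < s.H ∧ 0 < s.Ω ∧ 0 < s.Ωk ∧ 0 ≤ s.Ωm P t

end FullState

/-- `x` is a solution of the full system on the time interval `I`, in the physical phase space. -/
def IsFullSolution (P : Params) (I : Set ℝ) (x : ℝ → FullState) : Prop :=
  ∀ t ∈ I, (x t).Physical P t ∧
    HasDerivWithinAt (fun s => (x s).Ω) ((x t).dΩ P t) I t ∧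
    HasDerivWithinAt (fun s => (x s).Ωk) ((x t).dΩk P t) I t ∧
    HasDerivWithinAt (fun s => (x s).Φ) ((x t).dΦ P t) I t ∧
    HasDerivWithinAt (fun s => (x s).H) ((x t).dH P t) I t

/-! ### The averaged system -/

/-- A state of the averaged system, whose independent variable is `τ = log a`;
`time` is the cosmic time. -/
structure AvgState where
  Ω : ℝ
  Ωk : ℝ
  Φ : ℝ
  H : ℝ
  time : ℝ

namespace AvgState

/-- The pair of variables in which the equilibrium points are given. -/
def point (s : AvgState) : ℝ × ℝ := (s.Ω, s.Ωk)

/-- The averaged matter density fraction. -/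
def Ωm (s : AvgState) : ℝ := 1 - s.Ω ^ 2 - s.Ωk

/-- The deceleration parameter of the averaged system. -/
def q (P : Params) (s : AvgState) : ℝ :=
  -1 + 1 / 2 * (3 * P.γ * (1 - s.Ωk - s.Ω ^ 2) + 3 * s.Ω ^ 2 + 2 * s.Ωk)

/-- Right-hand side of the equation for `Ω`. -/
def dΩ (P : Params) (s : AvgState) : ℝ :=
  -(1 / 2) * s.Ω * (3 * (P.γ - 1) * (s.Ω ^ 2 - 1) + (3 * P.γ - 2) * s.Ωk)

/-- Right-hand side of the equation for `Ωk`. -/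
def dΩk (P : Params) (s : AvgState) : ℝ :=
  -s.Ωk * (3 * (P.γ - 1) * s.Ω ^ 2 - 3 * P.γ + (3 * P.γ - 2) * s.Ωk + 2)

/-- Right-hand side of the equation for `H`. -/
def dH (P : Params) (s : AvgState) : ℝ :=
  -(1 / 2) * s.H * (3 * P.γ * (1 - s.Ωk - s.Ω ^ 2) + 3 * s.Ω ^ 2 + 2 * s.Ωk)

/-- The phase space of the averaged system. -/
def Physical (s : AvgState) : Prop :=
  0 < s.H ∧ 0 ≤ s.Ωk ∧ s.Ω ^ 2 + s.Ωk ≤ 1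

end AvgState

/-- `y` is a solution of the averaged system on the `τ`-interval `I`, in its phase space. -/
def IsAvgSolution (P : Params) (I : Set ℝ) (y : ℝ → AvgState) : Prop :=
  ∀ τ ∈ I, (y τ).Physical ∧
    HasDerivWithinAt (fun s => (y s).Ω) ((y τ).dΩ P) I τ ∧
    HasDerivWithinAt (fun s => (y s).Ωk) ((y τ).dΩk P) I τ ∧
    HasDerivWithinAt (fun s => (y s).Φ) 0 I τ ∧
    HasDerivWithinAt (fun s => (y s).H) ((y τ).dH P) I τ ∧
    HasDerivWithinAt (fun s => (y s).time) (1 / (y τ).H) I τ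

/-! ### Equilibrium points and their line elements -/

/-- The matter dominated point, in the variables `(Ω, Ωk)`. -/
def F₀ : ℝ × ℝ := (0, 0)

/-- The curvature dominated (Milne) point, in the variables `(Ω, Ωk)`. -/
def C : ℝ × ℝ := (0, 1)

/-- `a(t) / a₀` for the matter dominated line element
`-dt² + a₀² (3 γ H₀ t / 2 + 1)^(4 / (3 γ)) (dr² + sinh² r dΩ²)`. -/
def matterScale (γ H₀ t : ℝ) : ℝ := (3 * γ * H₀ * t / 2 + 1) ^ (2 / (3 * γ))

/-- `a(t) / a₀` for the Milne line element `-dt² + a₀² (H₀ t + 1)² (dr² + sinh² r dΩ²)`. -/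
def milneScale (H₀ t : ℝ) : ℝ := H₀ * t + 1

/-- The averaged system rests at `p`, with any `H(0) = H₀ > 0` and `Φ`, and then the scale
factor `exp τ` is, as a function of the cosmic time `t` with `t(τ = 0) = 0`, `scale H₀ t`. -/
def RestsWithScale (P : Params) (p : ℝ × ℝ) (scale : ℝ → ℝ → ℝ) : Prop :=
  ∀ H₀ > 0, ∀ Φ₀ : ℝ, ∃ y : ℝ → AvgState, IsAvgSolution P univ y ∧
    (∀ τ, (y τ).point = p ∧ (y τ).Φ = Φ₀) ∧ (y 0).H = H₀ ∧ (y 0).time = 0 ∧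
    ∀ τ, Real.exp τ = scale H₀ (y τ).time

/-! ### Stability and late-time behaviour -/

/-- Lyapunov stability of `p` for the averaged system, relative to its phase space. -/
def AvgStable (P : Params) (p : ℝ × ℝ) : Prop :=
  ∀ ε > 0, ∃ δ > 0, ∀ (τ₀ τ₁ : ℝ) (y : ℝ → AvgState), IsAvgSolution P (Icc τ₀ τ₁) y →
    dist (y τ₀).point p < δ → ∀ τ ∈ Icc τ₀ τ₁, dist (y τ).point p < ε

/-- Lyapunov stability of `p` for the full system (in the variables `(Ω, Ωk)`), uniformly in the
initial time, in the initial phase and in the initial value of `H`, as long as the latter is at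
most `h`. -/
def FullStable (P : Params) (h : ℝ) (p : ℝ × ℝ) : Prop :=
  ∀ ε > 0, ∃ δ > 0, ∀ (t₀ t₁ : ℝ) (x : ℝ → FullState), IsFullSolution P (Icc t₀ t₁) x →
    (x t₀).H ≤ h → dist (x t₀).point p < δ → ∀ t ∈ Icc t₀ t₁, dist (x t).point p < ε

/-- Late-time behaviour of a solution of the averaged system: `(Ω, Ωk) → p`, the cosmic time tends
to infinity, `H → 0`, the deceleration parameter tends to `q∞`, `t H → 1 / (1 + q∞)`, and the scale
factor is asymptotically `a₀ * scale H₀ t` for some constants `a₀, H₀ > 0`. -/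
def AvgLateTime (P : Params) (y : ℝ → AvgState) (p : ℝ × ℝ) (qlim : ℝ) (scale : ℝ → ℝ → ℝ) : Prop :=
  Tendsto (fun τ => (y τ).point) atTop (𝓝 p) ∧
  Tendsto (fun τ => (y τ).time) atTop atTop ∧
  Tendsto (fun τ => (y τ).H) atTop (𝓝 0) ∧
  Tendsto (fun τ => (y τ).q P) atTop (𝓝 qlim) ∧
  Tendsto (fun τ => (y τ).time * (y τ).H) atTop (𝓝 (1 / (1 + qlim))) ∧
  ∃ a₀ > 0, ∃ H₀ > 0,
    Tendsto (fun τ => Real.exp τ / (a₀ * scale H₀ (y τ).time)) atTop (𝓝 1)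

/-- Late-time behaviour of a solution of the full system: `(Ω, Ωk) → p`, `H → 0`, the deceleration
parameter tends to `q∞`, `t H → 1 / (1 + q∞)`, and the scale factor is asymptotically
`a₀ * scale H₀ t` for some constants `a₀, H₀ > 0`. -/
def FullLateTime (P : Params) (x : ℝ → FullState) (p : ℝ × ℝ) (qlim : ℝ) (scale : ℝ → ℝ → ℝ) :
    Prop :=
  Tendsto (fun t => (x t).point) atTop (𝓝 p) ∧
  Tendsto (fun t => (x t).H) atTop (𝓝 0) ∧
  Tendsto (fun t => (x t).q P t) atTop (𝓝 qlim) ∧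
  Tendsto (fun t => t * (x t).H) atTop (𝓝 (1 / (1 + qlim))) ∧
  ∃ a₀ > 0, ∃ H₀ > 0,
    Tendsto (fun t => (x t).scaleFactor / (a₀ * scale H₀ t)) atTop (𝓝 1)

end OpenFLRW

end

/-! In both systems the squares of the density variables become simple after multiplication by `H ^
2`. In the averaged system the field, curvature and matter densities `Ω² H²`, `Ωk H²`, `Ωm H²` decay
exactly like `a⁻³`, `a⁻²`, `a^(-3γ)`, so the slowest one wins: matter for `γ < 2/3`, curvature for
`γ > 2/3`, both in a conserved ratio for `γ = 2/3`. A faster diluted fraction never grows relative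
to a slower one (`fraction_le`), and this gives stability.

No averaging theorem is used for the full system. Undoing the change of variables gives the
Einstein-scalar-fluid equations (`IsFullSolution.cosmicFlow`), where curvature and matter still
dilute exactly. Only the field energy `e` oscillates: `e' = -H p²`. By the virial theorem `p²`
averages to `φ V'(φ)`, which near the minimum is about `2 V`; hence `p²` averages to about `3 e` and
the field behaves as dust. The corrected logarithm `log e + H φ p / (2 e)` makes this rigorous: its
derivative is `-3 H + O(H²)`, the virial defect being cubic in `φ = O(H)`. For small `H` the error
costs less than the gap between the rate of dust and that of any component diluted no faster than
curvature (`CosmicFlow.exists_fieldDecays`). Since `H` decreases, smallness persists.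

Once one index `g` dominates, `1 + q → 3 g / 2`. Integrating `(1 / H)' = 1 + q` gives the
asymptotics of `t H`, and the conserved limit of `a^(3g) H²` fixes the scale factor
(`hubble_asymptotics`, `exists_tendsto_scale`). -/

namespace OpenFLRW

/-! ### Calculus on intervals -/

theorem antitoneOn_of_hasDerivWithinAt {I : Set ℝ} (hI : Convex ℝ I) {f f' : ℝ → ℝ}
    (hf : ∀ t ∈ I, HasDerivWithinAt f (f' t) I t) (hf' : ∀ t ∈ I, f' t ≤ 0) : AntitoneOn f I :=
  antitoneOn_of_hasDerivWithinAt_nonpos hI (fun t ht => (hf t ht).continuousWithinAt)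
    (fun t ht => (hf t (interior_subset ht)).mono interior_subset)
    (fun t ht => hf' t (interior_subset ht))

theorem monotoneOn_of_hasDerivWithinAt {I : Set ℝ} (hI : Convex ℝ I) {f f' : ℝ → ℝ}
    (hf : ∀ t ∈ I, HasDerivWithinAt f (f' t) I t) (hf' : ∀ t ∈ I, 0 ≤ f' t) : MonotoneOn f I :=
  monotoneOn_of_hasDerivWithinAt_nonneg hI (fun t ht => (hf t ht).continuousWithinAt)
    (fun t ht => (hf t (interior_subset ht)).mono interior_subset)
    (fun t ht => hf' t (interior_subset ht))

theorem eq_of_hasDerivWithinAt_zero {I : Set ℝ} (hI : Convex ℝ I) {f : ℝ → ℝ}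
    (hf : ∀ t ∈ I, HasDerivWithinAt f 0 I t) {s t : ℝ} (hs : s ∈ I) (ht : t ∈ I) : f s = f t := by
  have h1 := antitoneOn_of_hasDerivWithinAt hI hf (fun _ _ => le_rfl)
  have h2 := monotoneOn_of_hasDerivWithinAt hI hf (fun _ _ => le_rfl)
  rcases le_total s t with h | h
  · exact le_antisymm (h2 hs ht h) (h1 hs ht h)
  · exact le_antisymm (h1 ht hs h) (h2 ht hs h)

/-- A quantity diluted at the rate `k` along the logarithm `N` of the scale factor. -/
theorem dilution {I : Set ℝ} (hI : Convex ℝ I) {X N N' : ℝ → ℝ} {k : ℝ}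
    (hN : ∀ t ∈ I, HasDerivWithinAt N (N' t) I t)
    (hX : ∀ t ∈ I, HasDerivWithinAt X (-k * N' t * X t) I t) {s t : ℝ} (hs : s ∈ I) (ht : t ∈ I) :
    X t = X s * Real.exp (-k * (N t - N s)) := by
  have h := eq_of_hasDerivWithinAt_zero hI (f := fun u => X u * Real.exp (k * N u))
    (fun u hu => ((hX u hu).fun_mul ((hN u hu).const_mul k).exp).congr_deriv (by ring)) hs ht
  have e : Real.exp (-k * (N t - N s)) = Real.exp (k * N s) * Real.exp (-(k * N t)) := by
    rw [← Real.exp_add]; congr 1; ring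
  rw [e, ← mul_assoc]
  rw [h, mul_assoc, ← Real.exp_add]
  simp

/-- L'Hôpital's rule at infinity, with a diverging monotone denominator. -/
theorem tendsto_div_of_hasDerivWithinAt {t₀ c : ℝ} {F G G' r : ℝ → ℝ}
    (hF : ∀ t ∈ Ici t₀, HasDerivWithinAt F (r t * G' t) (Ici t₀) t)
    (hG : ∀ t ∈ Ici t₀, HasDerivWithinAt G (G' t) (Ici t₀) t)
    (hG' : ∀ t ∈ Ici t₀, 0 ≤ G' t) (hGtop : Tendsto G atTop atTop)
    (hr : Tendsto r atTop (𝓝 c)) : Tendsto (fun t => F t / G t) atTop (𝓝 c) := by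
  rw [Metric.tendsto_atTop]
  intro ε hε
  obtain ⟨T₁, hT₁⟩ := (Metric.tendsto_atTop.1 hr) (ε / 2) (by positivity)
  set T := max T₁ t₀ with hT
  have hsub : Ici T ⊆ Ici t₀ := Ici_subset_Ici.2 (le_max_right _ _)
  have hclose : ∀ t ∈ Ici T, |r t - c| < ε / 2 := fun t ht => by
    simpa [Real.dist_eq] using hT₁ t ((le_max_left _ _).trans ht)
  -- From `T` on, `F` is trapped between two multiples of `G`, up to constants that the divergence
  -- of `G` absorbs.
  have up : AntitoneOn (fun t => F t - (c + ε / 2) * G t) (Ici T) := by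
    refine antitoneOn_of_hasDerivWithinAt (convex_Ici T)
      (fun t ht => ((hF t (hsub ht)).mono hsub).fun_sub
        (((hG t (hsub ht)).mono hsub).const_mul (c + ε / 2))) (fun t ht => ?_)
    have := (abs_lt.1 (hclose t ht)).2
    nlinarith [hG' t (hsub ht)]
  have low : MonotoneOn (fun t => F t - (c - ε / 2) * G t) (Ici T) := by
    refine monotoneOn_of_hasDerivWithinAt (convex_Ici T)
      (fun t ht => ((hF t (hsub ht)).mono hsub).fun_sub
        (((hG t (hsub ht)).mono hsub).const_mul (c - ε / 2))) (fun t ht => ?_)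
    have := (abs_lt.1 (hclose t ht)).1
    nlinarith [hG' t (hsub ht)]
  set B := |F T - (c + ε / 2) * G T| + |F T - (c - ε / 2) * G T| + 1
  have hB : 0 < B := by positivity
  obtain ⟨T₂, hT₂⟩ := (eventually_atTop.1 (hGtop.eventually_gt_atTop (2 * B / ε)))
  refine ⟨max T T₂, fun t ht => ?_⟩
  have htT : T ≤ t := (le_max_left _ _).trans ht
  have hGt := hT₂ t ((le_max_right _ _).trans ht)
  have hGpos : 0 < G t := lt_trans (by positivity) hGt
  have h1 := up (mem_Ici.2 le_rfl) htT htT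
  have h2 := low (mem_Ici.2 le_rfl) htT htT
  simp only at h1 h2
  have h3 : B < ε / 2 * G t := by rw [div_lt_iff₀ hε] at hGt; linarith
  have a1 := le_abs_self (F T - (c + ε / 2) * G T)
  have a2 := neg_abs_le (F T - (c - ε / 2) * G T)
  have a3 := abs_nonneg (F T - (c + ε / 2) * G T)
  have a4 := abs_nonneg (F T - (c - ε / 2) * G T)
  rw [Real.dist_eq, abs_lt]
  constructor
  · rw [lt_sub_iff_add_lt, lt_div_iff₀ hGpos]
    linarith
  · rw [sub_lt_iff_lt_add, div_lt_iff₀ hGpos]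
    linarith

/-- If `1 + q → c > 0`, then the Hubble parameter is asymptotically `1 / (c t)`. -/
theorem hubble_asymptotics {t₀ c : ℝ} (hc : 0 < c) {H T T' r : ℝ → ℝ}
    (hHpos : ∀ t ∈ Ici t₀, 0 < H t)
    (hH : ∀ t ∈ Ici t₀, HasDerivWithinAt H (-r t * H t ^ 2 * T' t) (Ici t₀) t)
    (hT : ∀ t ∈ Ici t₀, HasDerivWithinAt T (T' t) (Ici t₀) t)
    (hT' : ∀ t ∈ Ici t₀, 0 ≤ T' t) (hTtop : Tendsto T atTop atTop)
    (hr : Tendsto r atTop (𝓝 c)) :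
    Tendsto H atTop (𝓝 0) ∧ Tendsto (fun t => T t * H t) atTop (𝓝 (1 / c)) := by
  -- The derivative of `1 / H` is `r T'`, so L'Hôpital's rule applies to `(1 / H) / T`.
  have h := tendsto_div_of_hasDerivWithinAt (F := fun t => (H t)⁻¹) (G := T) (r := r)
    (fun t ht => ((hH t ht).fun_inv (hHpos t ht).ne').congr_deriv (by
      have := (hHpos t ht).ne'
      field_simp)) hT hT' hTtop hr
  have h1 : Tendsto (fun t => T t * H t) atTop (𝓝 (1 / c)) := by
    refine (h.inv₀ hc.ne').congr' ?_ |>.trans (by rw [one_div])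
    filter_upwards with t
    simp [div_eq_mul_inv]
  refine ⟨?_, h1⟩
  have h2 := h1.mul (tendsto_inv_atTop_zero.comp hTtop)
  rw [mul_zero] at h2
  refine h2.congr' ?_
  filter_upwards [hTtop.eventually_gt_atTop 0] with t ht
  simp only [Function.comp]
  field_simp

/-! ### Line elements -/

/-- Curvature dilutes like a fluid of index `2 / 3`, so the Milne case needs no separate
asymptotics. -/
theorem milneScale_eq : milneScale = matterScale (2 / 3) := by
  funext H₀ t
  simp only [milneScale, matterScale]
  norm_num
  ring

/-- If `a ^ (3 g) H ^ 2` tends to a positive constant and `t H → 2 / (3 g)`, then the scale factor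
`a = exp N` is asymptotically that of the line element with index `g`. -/
theorem exists_tendsto_scale {N H T : ℝ → ℝ} {g c : ℝ} (hg : 0 < g) (hc : 0 < c)
    (hT : Tendsto T atTop atTop) (hHpos : ∀ᶠ t in atTop, 0 < H t)
    (hTH : Tendsto (fun t => T t * H t) atTop (𝓝 (2 / (3 * g))))
    (hN : Tendsto (fun t => Real.exp (3 * g * N t) * H t ^ 2) atTop (𝓝 c)) :
    ∃ a₀ > 0, ∃ H₀ > 0,
      Tendsto (fun t => Real.exp (N t) / (a₀ * matterScale g H₀ (T t))) atTop (𝓝 1) := by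
  set k := 1 / (3 * g) with hk
  have hkpos : 0 < k := by positivity
  have hq : Tendsto (fun t => (3 * g * T t / 2 + 1) * H t) atTop
      (𝓝 (3 * g / 2 * (2 / (3 * g)) + 0)) := by
    have hH0 : Tendsto H atTop (𝓝 0) := by
      have h2 := hTH.mul (tendsto_inv_atTop_zero.comp hT)
      rw [mul_zero] at h2
      refine h2.congr' ?_
      filter_upwards [hT.eventually_gt_atTop 0] with t ht
      simp only [Function.comp]
      field_simp
    exact ((hTH.const_mul (3 * g / 2)).add hH0).congr fun t => by ring
  have e1 : 3 * g / 2 * (2 / (3 * g)) + 0 = 1 := by field_simp; norm_num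
  rw [e1] at hq
  have hlim : Tendsto (fun t => (Real.exp (3 * g * N t) * H t ^ 2 /
      ((3 * g * T t / 2 + 1) * H t) ^ 2) ^ k) atTop (𝓝 (c ^ k)) := by
    have := (hN.div (hq.pow 2) (by norm_num)).rpow_const (p := k) (Or.inr hkpos.le)
    simpa using this
  -- As `T → ∞`, the choice of `H₀` only rescales `a₀`, so `H₀ = 1` will do. Since `(3 g T / 2 + 1)
  -- H → 1`, the remaining constant is `c ^ (1 / (3 g))`.
  refine ⟨c ^ k, by positivity, 1, one_pos, ?_⟩
  have hlim2 := hlim.div_const (c ^ k)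
  rw [div_self (by positivity)] at hlim2
  refine hlim2.congr' ?_
  filter_upwards [hT.eventually_gt_atTop 0, hHpos] with t ht hH
  have hbase : 0 < 3 * g * T t / 2 + 1 := by positivity
  have e2 : Real.exp (3 * g * N t) * H t ^ 2 / ((3 * g * T t / 2 + 1) * H t) ^ 2 =
      Real.exp (3 * g * N t) / (3 * g * T t / 2 + 1) ^ 2 := by
    field_simp
  have e3 : Real.exp (3 * g * N t) ^ k = Real.exp (N t) := by
    rw [← Real.exp_mul]; congr 1; rw [hk]; field_simp
  have e4 : ((3 * g * T t / 2 + 1) ^ 2) ^ k = matterScale g 1 (T t) := by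
    rw [matterScale, mul_one, ← Real.rpow_natCast, ← Real.rpow_mul hbase.le]
    congr 1
    rw [hk]; push_cast; ring
  rw [e2, Real.div_rpow (Real.exp_pos _).le (by positivity), e3, e4, div_div, mul_comm (c ^ k)]

/-- The logarithm of the scale is `2 / 3` times the difference quotient at `g = 0` of `log (3 g H₀ t
/ 2 + 1)`, whose derivative there is `3 H₀ t / 2`. -/
theorem tendsto_matterScale_zero (H₀ t : ℝ) :
    Tendsto (fun g => matterScale g H₀ t) (𝓝[>] 0) (𝓝 (Real.exp (H₀ * t))) := by
  have hd : HasDerivAt (fun g : ℝ => Real.log (3 * g * H₀ * t / 2 + 1)) (3 * H₀ * t / 2) 0 := by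
    have h : HasDerivAt (fun g : ℝ => 3 * g * H₀ * t / 2 + 1) (3 * H₀ * t / 2) 0 := by
      have := ((hasDerivAt_id (0 : ℝ)).const_mul (3 * H₀ * t / 2)).add_const 1
      refine (this.congr_deriv (by simp)).congr_of_eventuallyEq (.of_forall fun g => ?_)
      simp; ring
    exact (h.log (by norm_num)).congr_deriv (by norm_num)
  have hs := (hasDerivAt_iff_tendsto_slope.1 hd).mono_left
    (nhdsWithin_mono 0 (fun x (hx : 0 < x) => hx.ne'))
  have hl : Tendsto (fun g : ℝ => Real.log (3 * g * H₀ * t / 2 + 1) * (2 / (3 * g))) (𝓝[>] 0)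
      (𝓝 (H₀ * t)) := by
    refine ((hs.const_mul (2 / 3)).congr' ?_).trans (le_of_eq (by congr 1; ring))
    filter_upwards [self_mem_nhdsWithin] with g (hg : 0 < g)
    simp [slope_def_field]
    field_simp
  have hpos : ∀ᶠ g : ℝ in 𝓝[>] 0, 0 < 3 * g * H₀ * t / 2 + 1 := by
    have : ContinuousAt (fun g : ℝ => 3 * g * H₀ * t / 2 + 1) 0 := by fun_prop
    exact (this.eventually (lt_mem_nhds (by norm_num))).filter_mono nhdsWithin_le_nhds
  refine ((Real.continuous_exp.tendsto _).comp hl).congr' ?_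
  filter_upwards [hpos] with g hg
  simp only [Function.comp, matterScale]
  rw [Real.rpow_def_of_pos hg]

/-! ### The averaged system -/

/-- The averaged system at rest at a point `(0, κ)` in which the deceleration parameter is
`3 g / 2 - 1`. -/
theorem restsWithScale {P : Params} {g κ : ℝ} (hg : 0 < g) (h0 : 0 ≤ κ) (h1 : κ ≤ 1)
    (hκ : κ * (-3 * P.γ + (3 * P.γ - 2) * κ + 2) = 0)
    (hq : 3 * P.γ * (1 - κ) + 2 * κ = 3 * g) :
    RestsWithScale P (0, κ) (matterScale g) := by
  intro H₀ hH₀ Φ₀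
  refine ⟨fun τ => ⟨0, κ, Φ₀, H₀ * Real.exp (-(3 * g / 2) * τ),
    2 / (3 * g * H₀) * (Real.exp (3 * g / 2 * τ) - 1)⟩, fun τ _ => ⟨⟨by positivity, h0, ?_⟩, ?_, ?_,
    ?_, ?_, ?_⟩, fun τ => ⟨rfl, rfl⟩, ?_, ?_, fun τ => ?_⟩
  · simpa using h1
  · simpa [AvgState.dΩ] using hasDerivWithinAt_const τ univ (0 : ℝ)
  · refine (hasDerivWithinAt_const τ univ κ).congr_deriv ?_
    simp only [AvgState.dΩk]
    linear_combination hκ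
  · exact hasDerivWithinAt_const τ univ Φ₀
  · have := ((((hasDerivAt_id τ).const_mul (-(3 * g / 2))).exp).const_mul H₀).hasDerivWithinAt
      (s := univ)
    refine this.congr_deriv ?_
    simp only [AvgState.dH, id]
    linear_combination (1 / 2) * H₀ * Real.exp (-(3 * g / 2) * τ) * hq
  · have := (((((hasDerivAt_id τ).const_mul (3 * g / 2)).exp).sub_const 1).const_mul
      (2 / (3 * g * H₀))).hasDerivWithinAt (s := univ)
    refine this.congr_deriv ?_
    simp only [id, neg_mul, Real.exp_neg]
    field_simp
  · simp
  · simp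
  · simp only [matterScale]
    have : 3 * g * H₀ * (2 / (3 * g * H₀) * (Real.exp (3 * g / 2 * τ) - 1)) / 2 + 1 =
        Real.exp (3 * g / 2 * τ) := by field_simp; ring
    rw [this, ← Real.exp_mul]
    congr 1
    field_simp

section Averaged

variable {P : Params} {I : Set ℝ} {y : ℝ → AvgState}

/-- The right-hand side `dΩ` equals `(1 + q - 3 / 2) Ω`, so in `Ω² H²` the deceleration cancels and
the rate of dust remains. The next two laws arise by the same cancellation. -/
theorem IsAvgSolution.field_eq (hy : IsAvgSolution P I y) (hI : Convex ℝ I) {s τ : ℝ}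
    (hs : s ∈ I) (hτ : τ ∈ I) :
    (y τ).Ω ^ 2 * (y τ).H ^ 2 = (y s).Ω ^ 2 * (y s).H ^ 2 * Real.exp (-3 * (τ - s)) := by
  refine dilution hI (X := fun τ => (y τ).Ω ^ 2 * (y τ).H ^ 2) (N := id) (N' := fun _ => 1)
    (fun t _ => hasDerivWithinAt_id t I) (fun t ht => ?_) hs hτ
  obtain ⟨-, h1, -, -, h2, -⟩ := hy t ht
  refine ((h1.fun_pow 2).fun_mul (h2.fun_pow 2)).congr_deriv ?_
  simp only [AvgState.dΩ, AvgState.dH]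
  push_cast
  ring

theorem IsAvgSolution.curvature_eq (hy : IsAvgSolution P I y) (hI : Convex ℝ I) {s τ : ℝ}
    (hs : s ∈ I) (hτ : τ ∈ I) :
    (y τ).Ωk * (y τ).H ^ 2 = (y s).Ωk * (y s).H ^ 2 * Real.exp (-2 * (τ - s)) := by
  refine dilution hI (X := fun τ => (y τ).Ωk * (y τ).H ^ 2) (N := id) (N' := fun _ => 1)
    (fun t _ => hasDerivWithinAt_id t I) (fun t ht => ?_) hs hτ
  obtain ⟨-, -, h1, -, h2, -⟩ := hy t ht
  refine (h1.fun_mul (h2.fun_pow 2)).congr_deriv ?_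
  simp only [AvgState.dΩk, AvgState.dH]
  push_cast
  ring

theorem IsAvgSolution.matter_eq (hy : IsAvgSolution P I y) (hI : Convex ℝ I) {s τ : ℝ}
    (hs : s ∈ I) (hτ : τ ∈ I) :
    (y τ).Ωm * (y τ).H ^ 2 =
      (y s).Ωm * (y s).H ^ 2 * Real.exp (-(3 * P.γ) * (τ - s)) := by
  refine dilution hI (X := fun τ => (y τ).Ωm * (y τ).H ^ 2) (N := id) (N' := fun _ => 1)
    (fun t _ => hasDerivWithinAt_id t I) (fun t ht => ?_) hs hτ
  obtain ⟨-, h0, h1, -, h2, -⟩ := hy t ht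
  refine ((((h0.fun_pow 2).const_sub 1).fun_sub h1).fun_mul (h2.fun_pow 2)).congr_deriv ?_
  simp only [AvgState.dΩ, AvgState.dΩk, AvgState.dH, AvgState.Ωm]
  push_cast
  ring

/-- Of two density fractions, the one that is diluted faster does not grow relative to the other,
which is at most one. -/
theorem fraction_le {x x₀ z z₀ H H₀ k l s : ℝ} (hH : 0 < H) (hH₀ : 0 < H₀) (hkl : k ≤ l)
    (hs : 0 ≤ s) (hx : x * H ^ 2 = x₀ * H₀ ^ 2 * Real.exp (-k * s))
    (hz : z * H ^ 2 = z₀ * H₀ ^ 2 * Real.exp (-l * s)) (hx1 : x ≤ 1) (hx0 : 0 ≤ x₀)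
    (hz0 : 0 ≤ z₀) : z * x₀ ≤ z₀ := by
  have he : Real.exp (-l * s) ≤ Real.exp (-k * s) := Real.exp_le_exp.2 (by nlinarith)
  have h1 : z * x₀ * H ^ 2 ≤ z₀ * H ^ 2 := by
    calc z * x₀ * H ^ 2 = z₀ * x₀ * H₀ ^ 2 * Real.exp (-l * s) := by linear_combination x₀ * hz
      _ ≤ z₀ * x₀ * H₀ ^ 2 * Real.exp (-k * s) := by gcongr
      _ = z₀ * x * H ^ 2 := by linear_combination -z₀ * hx
      _ ≤ z₀ * 1 * H ^ 2 := by gcongr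
      _ = z₀ * H ^ 2 := by ring
  exact le_of_mul_le_mul_right h1 (by positivity)

theorem AvgState.Physical.Ωm_nonneg {s : AvgState} (h : s.Physical) : 0 ≤ s.Ωm := by
  have := h.2.2
  simp only [AvgState.Ωm]; linarith

theorem dist_zero_lt_iff {a b κ ε : ℝ} :
    dist (a, b) ((0 : ℝ), κ) < ε ↔ |a| < ε ∧ |b - κ| < ε := by
  simp [Prod.dist_eq, Real.dist_eq]

theorem avgStable_matter (hγ : P.γ ≤ 2 / 3) : AvgStable P F₀ := by
  intro ε hε
  -- The bound `1 / 4` keeps the initial matter fraction above `1 / 2`, so `fraction_le` lets `Ω²`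
  -- and `Ωk` at most double.
  refine ⟨min (1 / 4) (ε / 2), by positivity, fun τ₀ τ₁ y hy hd τ hτ => ?_⟩
  have hs : τ₀ ∈ Icc τ₀ τ₁ := ⟨le_rfl, hτ.1.trans hτ.2⟩
  have hI : Convex ℝ (Icc τ₀ τ₁) := convex_Icc τ₀ τ₁
  obtain ⟨pH, pk, p1⟩ := (hy τ hτ).1
  obtain ⟨pH', pk', p1'⟩ := (hy _ hs).1
  have hM := hy.matter_eq hI hs hτ
  have hsub : 0 ≤ τ - τ₀ := sub_nonneg.2 hτ.1
  simp only [AvgState.point, F₀, dist_zero_lt_iff, sub_zero, lt_min_iff] at hd ⊢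
  obtain ⟨⟨a1, b1⟩, a2, b2⟩ := hd
  have hm0 : 1 / 2 ≤ (y τ₀).Ωm := by
    have := (abs_lt.1 b1).2
    have := sq_abs (y τ₀).Ω
    simp only [AvgState.Ωm]
    nlinarith [abs_nonneg (y τ₀).Ω]
  have hm1 : (y τ).Ωm ≤ 1 := by simp only [AvgState.Ωm]; nlinarith [sq_nonneg (y τ).Ω]
  have r1 := fraction_le pH pH' (by linarith) hsub hM (hy.field_eq hI hs hτ) hm1
    (by linarith) (sq_nonneg _)
  have r2 := fraction_le pH pH' (by linarith) hsub hM (hy.curvature_eq hI hs hτ) hm1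
    (by linarith) pk'
  have b3 := (abs_lt.1 b2).2
  constructor
  · have h1 : (y τ).Ω ^ 2 < ε ^ 2 := by
      have : (y τ₀).Ω ^ 2 < (ε / 2) ^ 2 := sq_lt_sq' (by linarith [(abs_lt.1 a2).1]) (abs_lt.1 a2).2
      nlinarith [sq_nonneg (y τ).Ω]
    exact abs_lt_of_sq_lt_sq h1 hε.le
  · rw [abs_of_nonneg pk]
    nlinarith

theorem avgStable_milne (hγ : 2 / 3 < P.γ) : AvgStable P C := by
  intro ε hε
  -- The deficit `1 - Ωk` controls everything, as it bounds `Ω²`. With `Ωk ≥ 1 / 2` initially it at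
  -- most doubles, whence `ε / 4` for `Ωk` and `ε ^ 2 / 4` for `Ω`.
  refine ⟨min (1 / 2) (min (ε / 4) (ε ^ 2 / 4)), by positivity, fun τ₀ τ₁ y hy hd τ hτ => ?_⟩
  have hs : τ₀ ∈ Icc τ₀ τ₁ := ⟨le_rfl, hτ.1.trans hτ.2⟩
  have hI : Convex ℝ (Icc τ₀ τ₁) := convex_Icc τ₀ τ₁
  obtain ⟨pH, pk, p1⟩ := (hy τ hτ).1
  obtain ⟨pH', pk', p1'⟩ := (hy _ hs).1
  have hK := hy.curvature_eq hI hs hτ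
  have hsub : 0 ≤ τ - τ₀ := sub_nonneg.2 hτ.1
  simp only [AvgState.point, C, dist_zero_lt_iff, lt_min_iff] at hd ⊢
  obtain ⟨⟨-, b1⟩, ⟨-, b2⟩, -, b3⟩ := hd
  have hk1 : (y τ).Ωk ≤ 1 := by nlinarith [sq_nonneg (y τ).Ω]
  have r1 := fraction_le pH pH' (by norm_num) hsub hK (hy.field_eq hI hs hτ) hk1
    pk' (sq_nonneg _)
  have r2 := fraction_le pH pH' (by linarith) hsub hK (hy.matter_eq hI hs hτ) hk1
    pk' (hy _ hs).1.Ωm_nonneg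
  have hm := (hy _ hτ).1.Ωm_nonneg
  have hm' := (hy _ hs).1.Ωm_nonneg
  simp only [AvgState.Ωm] at r2 hm hm'
  have c1 := (abs_lt.1 b1).1
  have c2 := (abs_lt.1 b2).1
  have c3 := (abs_lt.1 b3).1
  have hsum : (1 - (y τ).Ωk) * (1 / 2) ≤ 1 - (y τ₀).Ωk := by nlinarith
  constructor
  · refine abs_lt_of_sq_lt_sq ?_ hε.le
    nlinarith
  · rw [abs_lt]
    constructor <;> nlinarith [sq_nonneg (y τ).Ω]

/-- Here `g` is the index of the dominant dilution. After scaling by `exp (3 g τ)` the field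
vanishes because `g < 1`, the densities sum to the scaled `H²`, and the fractions converge as
quotients. Hypothesis `hq` says that the limit of `1 + q` is `3 g / 2`. -/
theorem avgLateTime_of_tendsto {τ₀ : ℝ} (hy : IsAvgSolution P (Ici τ₀) y) (hγ : 0 < P.γ)
    {g k m : ℝ} (hg : 0 < g) (hg1 : g < 1) (hkm : 0 < k + m)
    (hq : 3 * P.γ * m + 2 * k = 3 * g * (k + m))
    (hK : Tendsto (fun τ => (y τ).Ωk * (y τ).H ^ 2 * Real.exp (3 * g * τ)) atTop (𝓝 k))
    (hM : Tendsto (fun τ => (y τ).Ωm * (y τ).H ^ 2 * Real.exp (3 * g * τ)) atTop (𝓝 m)) :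
    AvgLateTime P y (0, k / (k + m)) (3 * g / 2 - 1) (matterScale g) := by
  have hI : Convex ℝ (Ici τ₀) := convex_Ici τ₀
  have h0 : τ₀ ∈ Ici τ₀ := mem_Ici.2 le_rfl
  have hU : Tendsto (fun τ => (y τ).Ω ^ 2 * (y τ).H ^ 2 * Real.exp (3 * g * τ)) atTop (𝓝 0) := by
    have h1 : Tendsto (fun τ : ℝ => (y τ₀).Ω ^ 2 * (y τ₀).H ^ 2 * Real.exp (3 * τ₀) *
        Real.exp (-((3 - 3 * g) * τ))) atTop
        (𝓝 ((y τ₀).Ω ^ 2 * (y τ₀).H ^ 2 * Real.exp (3 * τ₀) * 0)) :=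
      (Real.tendsto_exp_neg_atTop_nhds_zero.comp
        (tendsto_id.const_mul_atTop (by linarith))).const_mul _
    rw [mul_zero] at h1
    refine h1.congr' ?_
    filter_upwards [eventually_ge_atTop τ₀] with τ hτ
    rw [hy.field_eq hI h0 hτ, mul_assoc, mul_assoc _ (Real.exp _) (Real.exp _), ← Real.exp_add,
      ← Real.exp_add]
    ring_nf
  have hS : Tendsto (fun τ => Real.exp (3 * g * τ) * (y τ).H ^ 2) atTop (𝓝 (k + m)) := by
    have := (hK.add hM).add hU
    rw [add_zero] at this
    refine this.congr fun τ => ?_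
    simp only [AvgState.Ωm]
    ring
  have hpos : ∀ᶠ τ in atTop, 0 < (y τ).H := by
    filter_upwards [eventually_ge_atTop τ₀] with τ hτ using (hy τ hτ).1.1
  have lim : ∀ {w : AvgState → ℝ} {c : ℝ},
      Tendsto (fun τ => w (y τ) * (y τ).H ^ 2 * Real.exp (3 * g * τ)) atTop (𝓝 c) →
      Tendsto (fun τ => w (y τ)) atTop (𝓝 (c / (k + m))) := by
    intro w c h
    refine (h.div hS hkm.ne').congr' ?_
    filter_upwards [hpos] with τ hτ
    simp only [Pi.div_apply]
    have := Real.exp_pos (3 * g * τ)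
    field_simp
  have lK := lim (w := AvgState.Ωk) hK
  have lM := lim (w := AvgState.Ωm) hM
  have lU := lim (w := fun s => s.Ω ^ 2) hU
  rw [zero_div] at lU
  have lΩ : Tendsto (fun τ => (y τ).Ω) atTop (𝓝 0) := by
    have := (Real.continuous_sqrt.tendsto _).comp lU
    simp only [Function.comp_def, Real.sqrt_sq_eq_abs, Real.sqrt_zero] at this
    exact (tendsto_zero_iff_abs_tendsto_zero _).2 this
  have lq : Tendsto (fun τ => (y τ).q P) atTop (𝓝 (3 * g / 2 - 1)) := by
    have h1 := ((((lM.const_mul (3 * P.γ)).add (lU.const_mul 3)).add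
      (lK.const_mul 2)).const_mul (1 / 2)).const_add (-1)
    refine (h1.congr fun τ => ?_).trans (le_of_eq ?_)
    · simp only [AvgState.q, AvgState.Ωm]; ring
    · congr 1
      field_simp
      linear_combination hq
  have hT : Tendsto (fun τ => (y τ).time) atTop atTop := by
    have hanti : AntitoneOn (fun τ => (y τ).H) (Ici τ₀) := by
      refine antitoneOn_of_hasDerivWithinAt hI (fun t ht => (hy t ht).2.2.2.2.1) fun t ht => ?_
      obtain ⟨pH, pk, p1⟩ := (hy t ht).1
      simp only [AvgState.dH]
      have : 0 ≤ (y t).H * (3 * P.γ * (1 - (y t).Ωk - (y t).Ω ^ 2) + 3 * (y t).Ω ^ 2 +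
        2 * (y t).Ωk) := by
        have : 0 ≤ 1 - (y t).Ωk - (y t).Ω ^ 2 := by linarith
        positivity
      linarith
    -- As `H` does not increase, cosmic time runs at least at the rate `1 / H(τ₀)`.
    have hmono : MonotoneOn (fun τ => (y τ).time - 1 / (y τ₀).H * τ) (Ici τ₀) := by
      refine monotoneOn_of_hasDerivWithinAt hI (fun t ht => (hy t ht).2.2.2.2.2.fun_sub
        ((hasDerivWithinAt_id t _).const_mul _)) fun t ht => ?_
      rw [mul_one, sub_nonneg]
      exact one_div_le_one_div_of_le (hy t ht).1.1 (hanti h0 ht ht)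
    have hH₀ := (hy _ h0).1.1
    refine tendsto_atTop_mono' _ ?_ (tendsto_atTop_add_const_right atTop
      ((y τ₀).time - 1 / (y τ₀).H * τ₀) (tendsto_id.const_mul_atTop (one_div_pos.2 hH₀)))
    filter_upwards [eventually_ge_atTop τ₀] with τ hτ
    have := hmono h0 hτ hτ
    simp only [id] at this ⊢
    linarith
  obtain ⟨lH, lTH⟩ := hubble_asymptotics (c := 3 * g / 2) (H := fun τ => (y τ).H)
    (T := fun τ => (y τ).time) (T' := fun τ => 1 / (y τ).H) (r := fun τ => 1 + (y τ).q P)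
    (by positivity) (fun t ht => (hy t ht).1.1)
    (fun t ht => (hy t ht).2.2.2.2.1.congr_deriv (by
      have := (hy t ht).1.1.ne'
      simp only [AvgState.dH, AvgState.q]
      field_simp
      ring))
    (fun t ht => (hy t ht).2.2.2.2.2) (fun t ht => (one_div_pos.2 (hy t ht).1.1).le) hT
    ((lq.const_add 1).trans (le_of_eq (by congr 1; ring)))
  refine ⟨?_, hT, lH, lq, lTH.trans (le_of_eq (by congr 2; ring)), ?_⟩
  · exact lΩ.prodMk_nhds lK
  · exact exists_tendsto_scale (N := id) hg hkm hT hpos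
      (lTH.trans (le_of_eq (by congr 1; field_simp))) hS

theorem tendsto_diluted {τ₀ k g : ℝ} {X : ℝ → ℝ} (hk : 3 * g < k)
    (hX : ∀ τ ∈ Ici τ₀, X τ = X τ₀ * Real.exp (-k * (τ - τ₀))) :
    Tendsto (fun τ => X τ * Real.exp (3 * g * τ)) atTop (𝓝 0) := by
  have h1 := (Real.tendsto_exp_neg_atTop_nhds_zero.comp
    (tendsto_id.const_mul_atTop (sub_pos.2 hk))).const_mul (X τ₀ * Real.exp (k * τ₀))
  rw [mul_zero] at h1
  refine h1.congr' ?_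
  filter_upwards [eventually_ge_atTop τ₀] with τ hτ
  simp only [Function.comp, id]
  rw [hX τ hτ, mul_assoc, mul_assoc, ← Real.exp_add, ← Real.exp_add]
  ring_nf

theorem tendsto_dominant {τ₀ g : ℝ} {X : ℝ → ℝ}
    (hX : ∀ τ ∈ Ici τ₀, X τ = X τ₀ * Real.exp (-(3 * g) * (τ - τ₀))) :
    Tendsto (fun τ => X τ * Real.exp (3 * g * τ)) atTop
      (𝓝 (X τ₀ * Real.exp (3 * g * τ₀))) := by
  refine tendsto_const_nhds.congr' ?_
  filter_upwards [eventually_ge_atTop τ₀] with τ hτ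
  rw [hX τ hτ, mul_assoc (X τ₀), ← Real.exp_add]
  ring_nf

theorem avgLateTime_matter {τ₀ : ℝ} (hy : IsAvgSolution P (Ici τ₀) y) (hγ : 0 < P.γ)
    (hγ' : P.γ < 2 / 3) (hm : 0 < (y τ₀).Ωm) :
    AvgLateTime P y F₀ ((3 * P.γ - 2) / 2) (matterScale P.γ) := by
  have h0 : τ₀ ∈ Ici τ₀ := mem_Ici.2 le_rfl
  have hH := (hy _ h0).1.1
  have := avgLateTime_of_tendsto hy hγ (g := P.γ) hγ (by linarith) (k := 0)
    (m := (y τ₀).Ωm * (y τ₀).H ^ 2 * Real.exp (3 * P.γ * τ₀)) (by positivity) (by ring)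
    (tendsto_diluted (X := fun τ => (y τ).Ωk * (y τ).H ^ 2) (k := 2) (by linarith)
      fun τ hτ => hy.curvature_eq (convex_Ici τ₀) h0 hτ)
    (tendsto_dominant (X := fun τ => (y τ).Ωm * (y τ).H ^ 2)
      fun τ hτ => hy.matter_eq (convex_Ici τ₀) h0 hτ)
  rw [zero_div] at this
  convert this using 1
  · rfl
  · ring

theorem avgLateTime_milne {τ₀ : ℝ} (hy : IsAvgSolution P (Ici τ₀) y)
    (hγ : 2 / 3 < P.γ) (hk : 0 < (y τ₀).Ωk) :
    AvgLateTime P y C 0 milneScale := by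
  have h0 : τ₀ ∈ Ici τ₀ := mem_Ici.2 le_rfl
  have hH := (hy _ h0).1.1
  have hpos : 0 < (y τ₀).Ωk * (y τ₀).H ^ 2 * Real.exp (3 * (2 / 3) * τ₀) := by positivity
  have := avgLateTime_of_tendsto hy (by linarith) (g := 2 / 3) (by norm_num) (by norm_num)
    (m := 0) (k := (y τ₀).Ωk * (y τ₀).H ^ 2 * Real.exp (3 * (2 / 3) * τ₀))
    (by linarith) (by ring)
    (tendsto_dominant (X := fun τ => (y τ).Ωk * (y τ).H ^ 2)
      fun τ hτ => by
        convert hy.curvature_eq (convex_Ici τ₀) h0 hτ using 4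
        norm_num)
    (tendsto_diluted (X := fun τ => (y τ).Ωm * (y τ).H ^ 2) (k := 3 * P.γ) (by linarith)
      fun τ hτ => hy.matter_eq (convex_Ici τ₀) h0 hτ)
  rw [add_zero, div_self hpos.ne'] at this
  rw [milneScale_eq]
  convert this using 1
  · rfl
  · norm_num

theorem avgLateTime_critical {τ₀ : ℝ} (hy : IsAvgSolution P (Ici τ₀) y)
    (hγ : P.γ = 2 / 3) (hkm : 0 < (y τ₀).Ωk + (y τ₀).Ωm) :
    AvgLateTime P y (0, (y τ₀).Ωk / ((y τ₀).Ωk + (y τ₀).Ωm)) 0 (matterScale P.γ) := by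
  have h0 : τ₀ ∈ Ici τ₀ := mem_Ici.2 le_rfl
  have hH := (hy _ h0).1.1
  have hf : 0 < (y τ₀).H ^ 2 * Real.exp (3 * P.γ * τ₀) := by positivity
  have := avgLateTime_of_tendsto hy (by linarith) (g := P.γ) (by linarith) (by linarith)
    (k := (y τ₀).Ωk * (y τ₀).H ^ 2 * Real.exp (3 * P.γ * τ₀))
    (m := (y τ₀).Ωm * (y τ₀).H ^ 2 * Real.exp (3 * P.γ * τ₀))
    (by nlinarith) (by rw [hγ]; ring)
    (tendsto_dominant (X := fun τ => (y τ).Ωk * (y τ).H ^ 2)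
      fun τ hτ => by
        convert hy.curvature_eq (convex_Ici τ₀) h0 hτ using 4
        norm_num [hγ])
    (tendsto_dominant (X := fun τ => (y τ).Ωm * (y τ).H ^ 2)
      fun τ hτ => hy.matter_eq (convex_Ici τ₀) h0 hτ)
  rw [← add_mul, ← add_mul, mul_assoc (y τ₀).Ωk,
    mul_assoc ((y τ₀).Ωk + _), mul_div_mul_right _ _ hf.ne'] at this
  convert this using 1
  rw [hγ]; norm_num

end Averaged

/-! ### The potential -/

/-- The quadratic terms cancel. Half angles give the factorisation `4 sin (y/2) (sin (y/2) - (y/2)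
cos (y/2))`; a linear bound on the first factor and a quadratic one on the second suffice. -/
theorem abs_virial_defect_le (y : ℝ) :
    |2 * (1 - Real.cos y) - y * Real.sin y| ≤ |y| ^ 3 := by
  have key : ∀ z : ℝ, 0 ≤ z → |Real.sin z - z * Real.cos z| ≤ 2 * z ^ 2 := fun z hz => by
    rcases hz.eq_or_lt with rfl | hz
    · simp
    rcases le_total z 1 with h1 | h1
    · have s1 := Real.sin_gt_sub_cube hz
      have s2 := Real.sin_lt hz
      have c1 := Real.one_sub_sq_div_two_le_cos (x := z)
      have c2 := Real.cos_le_one z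
      have hz2 : z * z ^ 2 ≤ 1 * z ^ 2 := by gcongr
      rw [abs_le]
      constructor <;> nlinarith [mul_le_mul_of_nonneg_left c1 hz.le,
        mul_le_mul_of_nonneg_left c2 hz.le]
    · have s1 := abs_le.1 (Real.abs_sin_le_one z)
      have c1 := abs_le.1 (Real.abs_cos_le_one z)
      rw [abs_le]
      constructor <;> nlinarith [mul_le_mul_of_nonneg_left c1.1 hz.le,
        mul_le_mul_of_nonneg_left c1.2 hz.le]
  have nonneg : ∀ y : ℝ, 0 ≤ y → |2 * (1 - Real.cos y) - y * Real.sin y| ≤ |y| ^ 3 := by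
    intro y hy
    have e : 2 * (1 - Real.cos y) - y * Real.sin y =
        4 * Real.sin (y / 2) * (Real.sin (y / 2) - y / 2 * Real.cos (y / 2)) := by
      have h1 : Real.cos y = 1 - 2 * Real.sin (y / 2) ^ 2 := by
        rw [Real.sin_sq, ← mul_div_cancel₀ y (two_ne_zero' ℝ)]
        rw [Real.cos_two_mul]; ring_nf
      have h2 : Real.sin y = 2 * Real.sin (y / 2) * Real.cos (y / 2) := by
        rw [← Real.sin_two_mul]; ring_nf
      rw [h1, h2]; ring
    have h1 := key (y / 2) (by positivity)
    have h2 : |Real.sin (y / 2)| ≤ y / 2 := by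
      have := Real.abs_sin_le_abs (x := y / 2)
      rwa [abs_of_nonneg (show 0 ≤ y / 2 by positivity)] at this
    rw [e, abs_mul, abs_mul, abs_of_nonneg hy, abs_of_pos (by norm_num : (0 : ℝ) < 4)]
    calc 4 * |Real.sin (y / 2)| * |Real.sin (y / 2) - y / 2 * Real.cos (y / 2)|
        ≤ 4 * (y / 2) * (2 * (y / 2) ^ 2) := by gcongr
      _ = y ^ 3 := by ring
  rcases le_total 0 y with h | h
  · exact nonneg y h
  · simpa using nonneg (-y) (by linarith)

/-- The conditions on the parameters. -/
structure Params.Admissible (P : Params) : Prop where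
  b_pos : 0 < P.b
  μ_pos : 0 < P.μ
  ω_sq : 2 * P.μ ^ 2 < P.ω ^ 2

/-- The derivative of the potential. -/
noncomputable def Params.force (P : Params) (φ : ℝ) : ℝ :=
  P.b * P.μ ^ 3 * Real.sin (φ / P.f) + 2 * P.μ ^ 2 * φ

/-- One third of the energy density of the scalar field. -/
noncomputable def Params.energy (P : Params) (φ p : ℝ) : ℝ := (p ^ 2 / 2 + P.V φ) / 3

section Potential

variable {P : Params}

theorem Params.Admissible.f_pos (hP : P.Admissible) : 0 < P.f :=
  div_pos (mul_pos hP.b_pos (pow_pos hP.μ_pos 3)) (sub_pos.2 hP.ω_sq)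

theorem Params.Admissible.f_mul (hP : P.Admissible) :
    P.f * (P.ω ^ 2 - 2 * P.μ ^ 2) = P.b * P.μ ^ 3 :=
  div_mul_cancel₀ _ (sub_pos.2 hP.ω_sq).ne'

theorem Params.Admissible.ω_ne (hP : P.Admissible) : P.ω ≠ 0 := by
  intro h
  have := hP.ω_sq
  rw [h] at this
  nlinarith [sq_nonneg P.μ]

theorem Params.Admissible.hasDerivAt_V (hP : P.Admissible) (φ : ℝ) :
    HasDerivAt P.V (P.force φ) φ := by
  have hf := hP.f_pos.ne'
  have hμ := hP.μ_pos.ne'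
  have h1 : HasDerivAt (fun x : ℝ => x / P.f) (1 / P.f) φ := (hasDerivAt_id φ).div_const _
  have h := (((h1.cos.const_sub 1).const_mul (P.b * P.f)).fun_add
    (((hasDerivAt_id φ).fun_pow 2).div_const P.μ)).const_mul (P.μ ^ 3)
  refine h.congr_deriv ?_
  simp only [Params.force, id]
  field_simp
  push_cast
  ring

theorem Params.Admissible.le_V (hP : P.Admissible) (φ : ℝ) : P.μ ^ 2 * φ ^ 2 ≤ P.V φ := by
  have hf := hP.f_pos
  have hμ := hP.μ_pos
  have hb := hP.b_pos
  have h : P.V φ = P.μ ^ 3 * (P.b * P.f * (1 - Real.cos (φ / P.f))) + P.μ ^ 2 * φ ^ 2 := by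
    simp only [Params.V]; field_simp
  have h2 : 0 ≤ 1 - Real.cos (φ / P.f) := sub_nonneg.2 (Real.cos_le_one _)
  rw [h]
  have : 0 ≤ P.μ ^ 3 * (P.b * P.f * (1 - Real.cos (φ / P.f))) := by positivity
  linarith

/-- The choice of `f` makes `V''(0) = ω²`, and `1 - cos x ≤ x² / 2` puts `V` below its quadratic
approximation. -/
theorem Params.Admissible.V_le (hP : P.Admissible) (φ : ℝ) : P.V φ ≤ P.ω ^ 2 / 2 * φ ^ 2 := by
  have hf := hP.f_pos
  have hμ := hP.μ_pos
  have hb := hP.b_pos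
  have h : P.V φ = P.μ ^ 3 * (P.b * P.f * (1 - Real.cos (φ / P.f))) + P.μ ^ 2 * φ ^ 2 := by
    simp only [Params.V]; field_simp
  have h2 : 1 - Real.cos (φ / P.f) ≤ (φ / P.f) ^ 2 / 2 := by
    linarith [Real.one_sub_sq_div_two_le_cos (x := φ / P.f)]
  rw [h]
  calc _ ≤ P.μ ^ 3 * (P.b * P.f * ((φ / P.f) ^ 2 / 2)) + P.μ ^ 2 * φ ^ 2 := by gcongr
    _ = P.ω ^ 2 / 2 * φ ^ 2 := by
      have e : P.μ ^ 3 * (P.b * P.f * ((φ / P.f) ^ 2 / 2)) =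
          (P.b * P.μ ^ 3) / P.f * (φ ^ 2 / 2) := by field_simp
      rw [e, ← hP.f_mul]
      field_simp
      ring

/-- The term `μ² φ²` satisfies `2 V = φ V'` exactly, so only the cosine contributes. -/
theorem Params.Admissible.abs_virial_le (hP : P.Admissible) (φ : ℝ) :
    |2 * P.V φ - φ * P.force φ| ≤ P.b * P.μ ^ 3 / P.f ^ 2 * |φ| ^ 3 := by
  have hf := hP.f_pos
  have hμ := hP.μ_pos
  have hb := hP.b_pos
  have e : 2 * P.V φ - φ * P.force φ = P.b * P.μ ^ 3 * P.f *
      (2 * (1 - Real.cos (φ / P.f)) - φ / P.f * Real.sin (φ / P.f)) := by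
    simp only [Params.V, Params.force]; field_simp; ring
  rw [e, abs_mul, abs_of_pos (by positivity : 0 < P.b * P.μ ^ 3 * P.f)]
  calc _ ≤ P.b * P.μ ^ 3 * P.f * |φ / P.f| ^ 3 := by gcongr; exact abs_virial_defect_le _
    _ = _ := by rw [abs_div, abs_of_pos hf]; field_simp

theorem Params.Admissible.kinetic_le (hP : P.Admissible) (φ p : ℝ) :
    p ^ 2 ≤ 6 * P.energy φ p := by
  have := hP.le_V φ
  have : 0 ≤ P.μ ^ 2 * φ ^ 2 := by positivity
  simp only [Params.energy]; linarith

theorem Params.Admissible.potential_le (hP : P.Admissible) (φ p : ℝ) :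
    P.μ ^ 2 * φ ^ 2 ≤ 3 * P.energy φ p := by
  have := hP.le_V φ
  have := sq_nonneg p
  simp only [Params.energy]; linarith

theorem Params.Admissible.abs_mul_le (hP : P.Admissible) (φ p : ℝ) :
    |φ * p| ≤ (3 / (2 * P.μ ^ 2) + 3) * P.energy φ p := by
  have h1 := hP.kinetic_le φ p
  have h2 := hP.potential_le φ p
  have hμ := hP.μ_pos
  have h3 : φ ^ 2 ≤ 3 / P.μ ^ 2 * P.energy φ p := by
    rw [div_mul_eq_mul_div, le_div_iff₀ (by positivity)]; linarith
  have h4 : |φ * p| ≤ (φ ^ 2 + p ^ 2) / 2 := by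
    rw [abs_le]; constructor <;> nlinarith [sq_nonneg (φ + p), sq_nonneg (φ - p)]
  have e : 3 / (2 * P.μ ^ 2) * P.energy φ p = 3 / P.μ ^ 2 * P.energy φ p / 2 := by
    field_simp
  linarith

theorem Params.Admissible.hasDerivWithinAt_energy (hP : P.Admissible) {I : Set ℝ} {t : ℝ}
    {φ p : ℝ → ℝ} {H : ℝ} (hφ : HasDerivWithinAt φ (p t) I t)
    (hp : HasDerivWithinAt p (-3 * H * p t - P.force (φ t)) I t) :
    HasDerivWithinAt (fun t => P.energy (φ t) (p t)) (-H * p t ^ 2) I t := by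
  have h := (((hp.fun_pow 2).div_const 2).fun_add
    ((hP.hasDerivAt_V (φ t)).comp_hasDerivWithinAt t hφ)).div_const 3
  refine h.congr_deriv ?_
  push_cast
  ring

/-- The terms of the logarithmic derivative of the corrected ratio of energy densities which are
of second order in the Hubble parameter. -/
theorem Params.Admissible.exists_remainder_le (hP : P.Admissible) :
    ∃ B > 0, ∀ φ p H H' : ℝ, 0 < H → 0 < P.energy φ p → P.energy φ p ≤ H ^ 2 →
      |H'| ≤ 3 * H ^ 2 →
      H * (2 * P.V φ - φ * P.force φ) / (2 * P.energy φ p) + H' * (φ * p) / (2 * P.energy φ p)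
        - 3 * H ^ 2 * (φ * p) / (2 * P.energy φ p)
        + H ^ 2 * (φ * p) * p ^ 2 / (2 * P.energy φ p ^ 2) ≤ B * H ^ 2 := by
  have hμ := hP.μ_pos
  have hf := hP.f_pos
  have hb := hP.b_pos
  set A := P.b * P.μ ^ 3 / P.f ^ 2 with hA
  set D := 3 / (2 * P.μ ^ 2) + 3 with hD
  have hApos : 0 < A := by positivity
  have hDpos : 0 < D := by positivity
  refine ⟨3 * A / P.μ ^ 3 + 6 * D, by positivity, fun φ p H H' hH he heH hH' => ?_⟩
  have k1 := hP.kinetic_le φ p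
  have k2 := hP.potential_le φ p
  have k3 := hP.abs_mul_le φ p
  have k4 := hP.abs_virial_le φ
  rw [← hD] at k3
  rw [← hA] at k4
  set e := P.energy φ p
  -- From `μ² φ² ≤ 3 e ≤ 3 H²`. In `t1` this bounds one factor of the cubic defect by `H`, and the
  -- other two by `e`.
  have hφ : |φ| ≤ 2 * H / P.μ := by
    rw [le_div_iff₀ hμ]
    refine abs_le_of_sq_le_sq' ?_ (by positivity) |>.2
    rw [mul_pow, sq_abs]
    nlinarith
  have t1 : H * (2 * P.V φ - φ * P.force φ) ≤ (3 * A / P.μ ^ 3 * H ^ 2) * (2 * e) := by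
    calc _ ≤ H * (A * |φ| ^ 3) := by gcongr; exact (le_abs_self _).trans k4
      _ = H * A * |φ| * φ ^ 2 := by rw [pow_succ, sq_abs]; ring
      _ ≤ H * A * (2 * H / P.μ) * (3 * e / P.μ ^ 2) := by
        gcongr
        rw [le_div_iff₀ (by positivity)]; linarith
      _ = _ := by field_simp
  have t2 : H' * (φ * p) ≤ (3 / 2 * D * H ^ 2) * (2 * e) := by
    calc _ ≤ |H'| * |φ * p| := by rw [← abs_mul]; exact le_abs_self _
      _ ≤ (3 * H ^ 2) * (D * e) := by gcongr
      _ = _ := by ring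
  have t3 : -(3 * H ^ 2 * (φ * p)) ≤ (3 / 2 * D * H ^ 2) * (2 * e) := by
    calc _ = 3 * H ^ 2 * (-(φ * p)) := by ring
      _ ≤ 3 * H ^ 2 * (D * e) := by gcongr; exact (neg_le_abs _).trans k3
      _ = _ := by ring
  have t4 : H ^ 2 * (φ * p) * p ^ 2 ≤ (3 * D * H ^ 2) * (2 * e ^ 2) := by
    calc _ ≤ H ^ 2 * (D * e) * (6 * e) :=
          mul_le_mul (mul_le_mul_of_nonneg_left ((le_abs_self _).trans k3) (sq_nonneg _)) k1
            (sq_nonneg _) (by positivity)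
      _ = _ := by ring
  rw [← div_le_iff₀ (by positivity)] at t1 t2 t3 t4
  rw [neg_div] at t3
  linarith

end Potential

/-! ### The Einstein equations in physical variables -/

/-- A homogeneous field `φ` with momentum `p`, in a universe with Hubble parameter `H`, curvature
`K = 1 / a ^ 2`, and a fluid with a third of its energy density `M`. -/
structure CosmicFlow (P : Params) (I : Set ℝ) (φ p H K M : ℝ → ℝ) : Prop where
  H_pos : ∀ t ∈ I, 0 < H t
  K_pos : ∀ t ∈ I, 0 < K t
  M_nonneg : ∀ t ∈ I, 0 ≤ M t
  energy_pos : ∀ t ∈ I, 0 < P.energy (φ t) (p t)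
  friedmann : ∀ t ∈ I, K t + M t + P.energy (φ t) (p t) = H t ^ 2
  deriv_φ : ∀ t ∈ I, HasDerivWithinAt φ (p t) I t
  deriv_p : ∀ t ∈ I, HasDerivWithinAt p (-3 * H t * p t - P.force (φ t)) I t
  deriv_H : ∀ t ∈ I, HasDerivWithinAt H (-(3 * P.γ / 2 * M t + K t + p t ^ 2 / 2)) I t
  deriv_K : ∀ t ∈ I, HasDerivWithinAt K (-2 * H t * K t) I t
  deriv_M : ∀ t ∈ I, HasDerivWithinAt M (-(3 * P.γ) * H t * M t) I t

/-- The logarithm of the scale factor. -/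
noncomputable def efolds (K : ℝ → ℝ) (t : ℝ) : ℝ := -Real.log (K t) / 2

/-! ### Decay of the field energy and asymptotics of the physical flow -/

namespace CosmicFlow

variable {P : Params} {I : Set ℝ} {φ p H K M : ℝ → ℝ}

theorem abs_deriv_H_le (F : CosmicFlow P I φ p H K M) (hP : P.Admissible) (hγ : 0 < P.γ)
    (hγ2 : P.γ < 2) {t : ℝ} (ht : t ∈ I) :
    |-(3 * P.γ / 2 * M t + K t + p t ^ 2 / 2)| ≤ 3 * H t ^ 2 := by
  have h1 := F.friedmann t ht
  have h2 := hP.kinetic_le (φ t) (p t)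
  have hM := F.M_nonneg t ht
  have hK := F.K_pos t ht
  have : 0 ≤ P.γ * M t := by positivity
  rw [abs_neg, abs_of_nonneg (by positivity)]
  nlinarith

theorem H_antitoneOn (F : CosmicFlow P I φ p H K M) (hI : Convex ℝ I) (hγ : 0 < P.γ) :
    AntitoneOn H I := by
  refine antitoneOn_of_hasDerivWithinAt hI F.deriv_H fun t ht => ?_
  have hM := F.M_nonneg t ht
  have hK := F.K_pos t ht
  rw [neg_nonpos]
  positivity

theorem deriv_efolds (F : CosmicFlow P I φ p H K M) {t : ℝ} (ht : t ∈ I) :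
    HasDerivWithinAt (efolds K) (H t) I t := by
  have hK := (F.K_pos t ht).ne'
  refine (((F.deriv_K t ht).log hK).fun_neg.div_const 2).congr_deriv ?_
  field_simp

theorem efolds_monotoneOn (F : CosmicFlow P I φ p H K M) (hI : Convex ℝ I) :
    MonotoneOn (efolds K) I :=
  monotoneOn_of_hasDerivWithinAt hI (fun _ ht => F.deriv_efolds ht) fun t ht => (F.H_pos t ht).le

theorem dilution (F : CosmicFlow P I φ p H K M) (hI : Convex ℝ I) {X : ℝ → ℝ} {k : ℝ}
    (hX : ∀ t ∈ I, HasDerivWithinAt X (-k * H t * X t) I t) {s t : ℝ} (hs : s ∈ I) (ht : t ∈ I) :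
    X t = X s * Real.exp (-k * (efolds K t - efolds K s)) :=
  OpenFLRW.dilution hI (fun _ ht => F.deriv_efolds ht) hX hs ht

/-- While `H ≤ h`, the oscillating field decays relative to any component which is diluted at most as
fast as curvature, up to the factor `D`. -/
def FieldDecays (P : Params) (h D : ℝ) : Prop :=
  ∀ (I : Set ℝ) (φ p H K M : ℝ → ℝ), CosmicFlow P I φ p H K M → Convex ℝ I →
    ∀ t₀ : ℝ, IsLeast I t₀ → H t₀ ≤ h → ∀ (X : ℝ → ℝ) (g : ℝ), g ≤ 2 / 3 →
    (∀ t ∈ I, 0 < X t) → (∀ t ∈ I, HasDerivWithinAt X (-(3 * g) * H t * X t) I t) →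
    ∀ t ∈ I, P.energy (φ t) (p t) / X t ≤
      D * (P.energy (φ t₀) (p t₀) / X t₀) * Real.exp (-((efolds K t - efolds K t₀) / 2))

/-- By the virial theorem, the oscillating field is diluted like dust. -/
theorem exists_fieldDecays (hP : P.Admissible) (hγ : 0 < P.γ) (hγ2 : P.γ < 2) :
    ∃ h > 0, ∃ D > 0, FieldDecays P h D := by
  obtain ⟨B, hB, hrem⟩ := hP.exists_remainder_le
  have hμ := hP.μ_pos
  set c := 3 / (2 * P.μ ^ 2) + 3 with hc
  -- With `H ≤ 1 / (2 B)` the remainder `B H²` is at most `H / 2`. The correction term is bounded by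
  -- `c / (4 B)` at each of the two times, which yields the exponent in `D`.
  refine ⟨1 / (2 * B), by positivity, Real.exp (1 / (2 * B) * c), Real.exp_pos _, ?_⟩
  intro I φ p H K M F hI t₀ ht₀ hH X g hg hX hX' t ht
  have hHle : ∀ s ∈ I, H s ≤ 1 / (2 * B) := fun s hs =>
    (F.H_antitoneOn hI hγ ht₀.1 hs (ht₀.2 hs)).trans hH
  -- The term `H φ p / (2 e)` removes the oscillation of `p²`; the term `efolds / 2` encodes the
  -- claimed rate, so the claim is that `L` decreases.
  set L : ℝ → ℝ := fun s => Real.log (P.energy (φ s) (p s)) - Real.log (X s)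
    + H s * (φ s * p s) / (2 * P.energy (φ s) (p s)) + efolds K s / 2 with hL
  have hanti : AntitoneOn L I := by
    refine antitoneOn_of_hasDerivWithinAt hI
      (f' := fun s => -H s * p s ^ 2 / P.energy (φ s) (p s) + 3 * g * H s
        + ((-(3 * P.γ / 2 * M s + K s + p s ^ 2 / 2) * (φ s * p s)
          + H s * (p s ^ 2 - 3 * H s * (φ s * p s) - φ s * P.force (φ s)))
            / (2 * P.energy (φ s) (p s))
          + H s ^ 2 * (φ s * p s) * p s ^ 2 / (2 * P.energy (φ s) (p s) ^ 2)) + H s / 2)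
      (fun s hs => ?_) fun s hs => ?_
    · have he := (F.energy_pos s hs).ne'
      have hx := (hX s hs).ne'
      have de := hP.hasDerivWithinAt_energy (F.deriv_φ s hs) (F.deriv_p s hs)
      refine ((((de.log he).fun_sub ((hX' s hs).log hx)).fun_add
        (((F.deriv_H s hs).fun_mul ((F.deriv_φ s hs).fun_mul (F.deriv_p s hs))).fun_div
          (de.const_mul 2) (mul_ne_zero two_ne_zero he))).fun_add
        ((F.deriv_efolds hs).div_const 2)).congr_deriv ?_
      field_simp
      ring
    · have he := F.energy_pos s hs
      have hr := hrem (φ s) (p s) (H s) _ (F.H_pos s hs) he (by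
        have := F.friedmann s hs
        linarith [F.K_pos s hs, F.M_nonneg s hs]) (F.abs_deriv_H_le hP hγ hγ2 hs)
      have hHs := F.H_pos s hs
      have hsmall : B * H s ≤ 1 / 2 := by
        calc B * H s ≤ B * (1 / (2 * B)) := by gcongr; exact hHle s hs
          _ = 1 / 2 := by field_simp
      have e6 : 2 * P.V (φ s) = 6 * P.energy (φ s) (p s) - p s ^ 2 := by
        simp only [Params.energy]; ring
      rw [e6] at hr
      set e := P.energy (φ s) (p s)
      set H' := -(3 * P.γ / 2 * M s + K s + p s ^ 2 / 2)
      -- The correction contributes `H (p² - φ V') / (2 e)`, which turns `-H p² / e` into `-3 H`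
      -- plus the virial defect. Then `g ≤ 2 / 3` gives `3 g - 5 / 2 ≤ -1 / 2`, which absorbs the
      -- remainder.
      have key : -H s * p s ^ 2 / e + 3 * g * H s
          + ((H' * (φ s * p s) + H s * (p s ^ 2 - 3 * H s * (φ s * p s) - φ s * P.force (φ s)))
            / (2 * e) + H s ^ 2 * (φ s * p s) * p s ^ 2 / (2 * e ^ 2)) + H s / 2 =
          (3 * g - 5 / 2) * H s + (H s * (6 * e - p s ^ 2 - φ s * P.force (φ s)) / (2 * e)
            + H' * (φ s * p s) / (2 * e) - 3 * H s ^ 2 * (φ s * p s) / (2 * e)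
            + H s ^ 2 * (φ s * p s) * p s ^ 2 / (2 * e ^ 2)) := by
        field_simp
        ring
      rw [key]
      nlinarith
  have hcorr : ∀ s ∈ I, |H s * (φ s * p s) / (2 * P.energy (φ s) (p s))| ≤ 1 / (2 * B) * c / 2 := by
    intro s hs
    have he := F.energy_pos s hs
    rw [abs_div, abs_of_pos (by positivity : 0 < 2 * P.energy (φ s) (p s)), div_le_iff₀ (by positivity),
      abs_mul, abs_of_pos (F.H_pos s hs)]
    calc H s * |φ s * p s| ≤ 1 / (2 * B) * (c * P.energy (φ s) (p s)) :=
          mul_le_mul (hHle s hs) (hP.abs_mul_le _ _) (abs_nonneg _) (by positivity)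
      _ = _ := by ring
  have h1 := hanti ht₀.1 ht (ht₀.2 ht)
  have h2 := (abs_le.1 (hcorr t ht)).1
  have h3 := (abs_le.1 (hcorr t₀ ht₀.1)).2
  have r0 : 0 < P.energy (φ t₀) (p t₀) / X t₀ := div_pos (F.energy_pos _ ht₀.1) (hX _ ht₀.1)
  have r1 : 0 < P.energy (φ t) (p t) / X t := div_pos (F.energy_pos _ ht) (hX _ ht)
  rw [← Real.exp_log r0, ← Real.exp_log r1, ← Real.exp_add, ← Real.exp_add, Real.exp_le_exp,
    Real.log_div (F.energy_pos _ ht).ne' (hX _ ht).ne',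
    Real.log_div (F.energy_pos _ ht₀.1).ne' (hX _ ht₀.1).ne']
  simp only [hL] at h1
  linarith

/-- Since `|H'| ≤ 3 H²`, `1 / H` grows at most linearly, so the integral of `H` diverges at least
logarithmically. -/
theorem efolds_tendsto {t₀ : ℝ} (F : CosmicFlow P (Ici t₀) φ p H K M) (hP : P.Admissible)
    (hγ : 0 < P.γ) (hγ2 : P.γ < 2) : Tendsto (efolds K) atTop atTop := by
  have hI : Convex ℝ (Ici t₀) := convex_Ici t₀
  have h0 : t₀ ∈ Ici t₀ := mem_Ici.2 le_rfl
  have hH₀ := F.H_pos _ h0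
  have hinv : AntitoneOn (fun t => (H t)⁻¹ - 3 * t) (Ici t₀) := by
    refine antitoneOn_of_hasDerivWithinAt hI (fun t ht =>
      ((F.deriv_H t ht).fun_inv (F.H_pos t ht).ne').fun_sub
        ((hasDerivWithinAt_id t _).const_mul 3)) fun t ht => ?_
    have hH := F.H_pos t ht
    have := (abs_le.1 (F.abs_deriv_H_le hP hγ hγ2 ht)).1
    rw [mul_one, sub_nonpos, div_le_iff₀ (by positivity)]
    linarith
  set b : ℝ → ℝ := fun t => (H t₀)⁻¹ + 3 * (t - t₀) with hb
  have hbpos : ∀ t ∈ Ici t₀, 0 < b t := fun t ht => by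
    have := sub_nonneg.2 (mem_Ici.1 ht)
    simp only [hb]; positivity
  have hmono : MonotoneOn (fun t => efolds K t - Real.log (b t) / 3) (Ici t₀) := by
    refine monotoneOn_of_hasDerivWithinAt hI (f' := fun t => H t - 1 / b t) (fun t ht => ?_)
      fun t ht => ?_
    · have hd : HasDerivWithinAt b 3 (Ici t₀) t := by
        have := ((((hasDerivWithinAt_id t (Ici t₀)).sub_const t₀).const_mul 3).const_add (H t₀)⁻¹)
        exact this.congr_deriv (by simp)
      refine ((F.deriv_efolds ht).fun_sub ((hd.log (hbpos t ht).ne').div_const 3)).congr_deriv ?_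
      have := (hbpos t ht).ne'
      field_simp
    · have h1 := hinv h0 ht ht
      have hH := F.H_pos t ht
      simp only at h1
      rw [sub_nonneg, one_div, inv_le_comm₀ (hbpos t ht) hH]
      simp only [hb]
      linarith
  have hbtop : Tendsto (fun t => Real.log (b t) / 3) atTop atTop := by
    refine (Real.tendsto_log_atTop.comp ?_).atTop_div_const (by norm_num)
    exact tendsto_atTop_add_const_left _ _
      ((tendsto_atTop_add_const_right _ _ tendsto_id).const_mul_atTop (by norm_num))
  refine tendsto_atTop_mono' _ ?_ (tendsto_atTop_add_const_right _
    (efolds K t₀ - Real.log (b t₀) / 3) hbtop)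
  filter_upwards [eventually_ge_atTop t₀] with t ht
  have := hmono h0 ht ht
  simp only at this
  linarith

/-- Late-time behaviour, in terms of the dominant component `X` with index `g`. -/
theorem lateTime {t₀ : ℝ} (F : CosmicFlow P (Ici t₀) φ p H K M) (hP : P.Admissible)
    {X : ℝ → ℝ} {g k m : ℝ} (hg : 0 < g)
    (hX : ∀ t ∈ Ici t₀, 0 < X t)
    (hX' : ∀ t ∈ Ici t₀, HasDerivWithinAt X (-(3 * g) * H t * X t) (Ici t₀) t)
    (hE : Tendsto (fun t => P.energy (φ t) (p t) / X t) atTop (𝓝 0))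
    (hK : Tendsto (fun t => K t / X t) atTop (𝓝 k))
    (hM : Tendsto (fun t => M t / X t) atTop (𝓝 m))
    (hkm : 0 < k + m) (hq : 3 * P.γ * m + 2 * k = 3 * g * (k + m)) :
    Tendsto (fun t => K t / H t ^ 2) atTop (𝓝 (k / (k + m))) ∧
    Tendsto (fun t => P.energy (φ t) (p t) / H t ^ 2) atTop (𝓝 0) ∧
    Tendsto H atTop (𝓝 0) ∧
    Tendsto (fun t => (3 * P.γ / 2 * M t + K t + p t ^ 2 / 2) / H t ^ 2) atTop (𝓝 (3 * g / 2)) ∧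
    Tendsto (fun t => t * H t) atTop (𝓝 (2 / (3 * g))) ∧
    ∃ a₀ > 0, ∃ H₀ > 0,
      Tendsto (fun t => Real.exp (efolds K t) / (a₀ * matterScale g H₀ t)) atTop (𝓝 1) := by
  have hI : Convex ℝ (Ici t₀) := convex_Ici t₀
  have h0 : t₀ ∈ Ici t₀ := mem_Ici.2 le_rfl
  have hev : ∀ᶠ t in atTop, t ∈ Ici t₀ := eventually_ge_atTop t₀
  have hS : Tendsto (fun t => H t ^ 2 / X t) atTop (𝓝 (k + m)) := by
    have := (hK.add hM).add hE
    rw [add_zero] at this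
    refine this.congr' ?_
    filter_upwards [hev] with t ht
    rw [← F.friedmann t ht, add_div, add_div]
  have lim : ∀ {Y : ℝ → ℝ} {c : ℝ}, Tendsto (fun t => Y t / X t) atTop (𝓝 c) →
      Tendsto (fun t => Y t / H t ^ 2) atTop (𝓝 (c / (k + m))) := by
    intro Y c h
    refine (h.div hS hkm.ne').congr' ?_
    filter_upwards [hev] with t ht
    exact div_div_div_cancel_right₀ (hX t ht).ne' _ _
  have lK := lim hK
  have lM := lim hM
  have lE := lim hE
  rw [zero_div] at lE
  have lp : Tendsto (fun t => p t ^ 2 / 2 / H t ^ 2) atTop (𝓝 0) := by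
    refine squeeze_zero' (.of_forall fun t => by positivity) ?_ (by simpa using lE.const_mul 3)
    filter_upwards with t
    rw [← mul_div_assoc]
    gcongr
    linarith [hP.kinetic_le (φ t) (p t)]
  have lr : Tendsto (fun t => (3 * P.γ / 2 * M t + K t + p t ^ 2 / 2) / H t ^ 2) atTop
      (𝓝 (3 * g / 2)) := by
    refine ((((lM.const_mul (3 * P.γ / 2)).add lK).add lp).congr fun t => ?_).trans
      (le_of_eq ?_)
    · rw [add_div, add_div, mul_div_assoc (3 * P.γ / 2)]
    · congr 1
      field_simp
      linear_combination hq
  obtain ⟨lH, lTH⟩ := hubble_asymptotics (c := 3 * g / 2) (T := id) (T' := fun _ => 1)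
    (r := fun t => (3 * P.γ / 2 * M t + K t + p t ^ 2 / 2) / H t ^ 2)
    (by positivity) F.H_pos
    (fun t ht => (F.deriv_H t ht).congr_deriv (by
      have := (F.H_pos t ht).ne'
      field_simp))
    (fun t _ => hasDerivWithinAt_id t _) (fun _ _ => zero_le_one) tendsto_id lr
  have lTH' : Tendsto (fun t => t * H t) atTop (𝓝 (2 / (3 * g))) :=
    lTH.trans (le_of_eq (by congr 1; field_simp))
  refine ⟨lK, lE, lH, lr, lTH', ?_⟩
  have hpos : 0 < X t₀ * Real.exp (3 * g * efolds K t₀) := mul_pos (hX _ h0) (Real.exp_pos _)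
  refine exists_tendsto_scale (T := id) hg (mul_pos hpos hkm) tendsto_id
    (hev.mono fun t ht => F.H_pos t ht) lTH' ?_
  -- The product `X a^(3g)` is constant, so the limit of `H² / X` is, up to that constant, the limit
  -- of `a^(3g) H²`.
  refine (hS.const_mul (X t₀ * Real.exp (3 * g * efolds K t₀))).congr' ?_
  filter_upwards [hev] with t ht
  have h1 := F.dilution hI hX' h0 ht
  have h2 : X t * Real.exp (3 * g * efolds K t) = X t₀ * Real.exp (3 * g * efolds K t₀) := by
    rw [h1, mul_assoc, ← Real.exp_add]
    ring_nf
  rw [← h2]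
  have := (hX t ht).ne'
  field_simp

end CosmicFlow

/-! ### The full system in physical variables -/

namespace FullState

variable {P : Params} {t : ℝ} {s : FullState}

/-- The derivative of the scalar field. -/
noncomputable def momentum (P : Params) (t : ℝ) (s : FullState) : ℝ :=
  √6 * s.H * s.Ω * Real.cos (s.θ P t)

theorem sqrt_three_halves : √(3 / 2 : ℝ) = √6 / 2 := by
  rw [show (3 / 2 : ℝ) = 6 / 2 ^ 2 by norm_num, Real.sqrt_div (by norm_num),
    Real.sqrt_sq (by norm_num)]

theorem cos_field (P : Params) (t : ℝ) (s : FullState) : Real.cos (s.φ P t / P.f) =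
    1 - 2 * Real.sin (√(3 / 2) * s.H * s.Ω * Real.sin (s.θ P t) / (P.f * P.ω)) ^ 2 := by
  have : s.φ P t / P.f =
      2 * (√(3 / 2) * s.H * s.Ω * Real.sin (s.θ P t) / (P.f * P.ω)) := by
    rw [φ, sqrt_three_halves, div_div, mul_comm P.ω]
    ring
  rw [this, Real.cos_two_mul, Real.sin_sq]
  ring

theorem field_div (P : Params) (t : ℝ) (s : FullState) :
    √6 * s.H * s.Ω * Real.sin (s.θ P t) / (P.f * P.ω) = s.φ P t / P.f := by
  rw [φ, div_div, mul_comm P.ω]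

/-- With `V ≤ ω² φ² / 2` the energy lies below that of the harmonic oscillator, which is `Ω² H²`.
Together with `le_energy` this makes smallness of `Ω` and of the energy fraction equivalent. -/
theorem energy_le (P : Params) (t : ℝ) (s : FullState) (hP : P.Admissible) :
    P.energy (s.φ P t) (s.momentum P t) ≤ s.Ω ^ 2 * s.H ^ 2 := by
  have h1 := hP.V_le (s.φ P t)
  have h6 : √6 ^ 2 = (6 : ℝ) := Real.sq_sqrt (by norm_num)
  have hω := hP.ω_ne
  have e1 : P.ω ^ 2 / 2 * s.φ P t ^ 2 = 3 * (s.H * s.Ω) ^ 2 * Real.sin (s.θ P t) ^ 2 := by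
    simp only [φ]
    field_simp
    rw [h6]; ring
  have e2 : s.momentum P t ^ 2 = 6 * (s.H * s.Ω) ^ 2 * Real.cos (s.θ P t) ^ 2 := by
    simp only [momentum, mul_pow, h6]; ring
  rw [e1] at h1
  have := Real.sin_sq_add_cos_sq (s.θ P t)
  simp only [Params.energy]
  rw [e2]
  have e3 : s.Ω ^ 2 * s.H ^ 2 = (s.H * s.Ω) ^ 2 * (Real.sin (s.θ P t) ^ 2 +
    Real.cos (s.θ P t) ^ 2) := by rw [this]; ring
  rw [e3]
  linarith

theorem le_energy (P : Params) (t : ℝ) (s : FullState) (hP : P.Admissible) :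
    2 * P.μ ^ 2 * (s.Ω ^ 2 * s.H ^ 2) ≤ P.ω ^ 2 * P.energy (s.φ P t) (s.momentum P t) := by
  have h1 := hP.le_V (s.φ P t)
  have h6 : √6 ^ 2 = (6 : ℝ) := Real.sq_sqrt (by norm_num)
  have hω := hP.ω_ne
  have e1 : P.ω ^ 2 * s.φ P t ^ 2 = 6 * (s.H * s.Ω) ^ 2 * Real.sin (s.θ P t) ^ 2 := by
    simp only [φ]
    field_simp
    rw [h6]; ring
  have e2 : s.momentum P t ^ 2 = 6 * (s.H * s.Ω) ^ 2 * Real.cos (s.θ P t) ^ 2 := by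
    simp only [momentum, mul_pow, h6]; ring
  have h2 : P.ω ^ 2 * (P.μ ^ 2 * s.φ P t ^ 2) ≤ P.ω ^ 2 * P.V (s.φ P t) := by gcongr
  have h3 : P.ω ^ 2 * (P.μ ^ 2 * s.φ P t ^ 2) =
      6 * P.μ ^ 2 * (s.H * s.Ω) ^ 2 * Real.sin (s.θ P t) ^ 2 := by
    linear_combination P.μ ^ 2 * e1
  have h4 : 2 * P.μ ^ 2 * ((s.H * s.Ω) ^ 2 * Real.cos (s.θ P t) ^ 2) ≤
      P.ω ^ 2 * ((s.H * s.Ω) ^ 2 * Real.cos (s.θ P t) ^ 2) :=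
    mul_le_mul_of_nonneg_right hP.ω_sq.le (by positivity)
  simp only [Params.energy]
  rw [e2]
  have e3 : s.Ω ^ 2 * s.H ^ 2 = (s.H * s.Ω) ^ 2 * (Real.sin (s.θ P t) ^ 2 +
    Real.cos (s.θ P t) ^ 2) := by rw [Real.sin_sq_add_cos_sq]; ring
  rw [e3]
  linarith

theorem friedmann (h : s.H ≠ 0) : s.Ωk * s.H ^ 2 + s.Ωm P t * s.H ^ 2 +
    P.energy (s.φ P t) (s.momentum P t) = s.H ^ 2 := by
  have h6 : √6 ^ 2 = (6 : ℝ) := Real.sq_sqrt (by norm_num)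
  simp only [Ωm, Params.energy, momentum, mul_pow, h6]
  field_simp
  ring

theorem Physical.energy_pos (h : s.Physical P t) (hP : P.Admissible) :
    0 < P.energy (s.φ P t) (s.momentum P t) := by
  have h1 := le_energy P t s hP
  obtain ⟨hH, hΩ, -, -⟩ := h
  have hμ := hP.μ_pos
  have : 0 < 2 * P.μ ^ 2 * (s.Ω ^ 2 * s.H ^ 2) := by positivity
  exact pos_of_mul_pos_right (this.trans_le h1) (sq_nonneg _)

/-- Eliminating `Ωm` by the constraint recovers the Raychaudhuri equation, linear in the physical
densities apart from `p²`. -/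
theorem one_add_q_mul (hP : P.Admissible) (h : s.H ≠ 0) : (1 + s.q P t) * s.H ^ 2 =
    3 * P.γ / 2 * (s.Ωm P t * s.H ^ 2) + s.Ωk * s.H ^ 2 + s.momentum P t ^ 2 / 2 := by
  have h6 : √6 ^ 2 = (6 : ℝ) := Real.sq_sqrt (by norm_num)
  have hω := hP.ω_ne
  have hμ := hP.μ_pos.ne'
  have hV : P.V (s.φ P t) = P.b * P.f * P.μ ^ 3 * (2 *
      Real.sin (√(3 / 2) * s.H * s.Ω * Real.sin (s.θ P t) / (P.f * P.ω)) ^ 2) +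
      P.μ ^ 2 * (6 * s.H ^ 2 * s.Ω ^ 2 * Real.sin (s.θ P t) ^ 2 / P.ω ^ 2) := by
    simp only [Params.V]
    rw [cos_field]
    have : s.φ P t ^ 2 = 6 * s.H ^ 2 * s.Ω ^ 2 * Real.sin (s.θ P t) ^ 2 / P.ω ^ 2 := by
      simp only [φ, div_pow, mul_pow, h6]
    rw [this]
    field_simp
    ring
  simp only [Ωm, hV, q, momentum, mul_pow, h6]
  generalize Real.sin (√(3 / 2) * s.H * s.Ω * Real.sin (s.θ P t) / (P.f * P.ω)) = S
  field_simp
  ring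

theorem dΩk_eq (h : s.H ≠ 0) : s.dΩk P t = 2 * s.q P t * s.H * s.Ωk := by
  simp only [dΩk]
  rw [field_div, cos_field]
  simp only [q]
  generalize Real.sin (√(3 / 2) * s.H * s.Ω * Real.sin (s.θ P t) / (P.f * P.ω)) = S
  field_simp
  ring

/-- The first term cancels against `H'` when `H Ω` is differentiated. The rest is the radial part of
the Klein-Gordon equation in polar form; `Ω_mul_dΦ` is the angular part. -/
theorem dΩ_eq (h : s.H ≠ 0) : s.dΩ P t = (1 + s.q P t) * s.H * s.Ω +
    (-3 * s.H * s.Ω * Real.cos (s.θ P t) ^ 2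
      - P.b * P.μ ^ 3 / (√6 * s.H) * Real.cos (s.θ P t) * Real.sin (s.φ P t / P.f)
      + (P.ω ^ 2 - 2 * P.μ ^ 2) / P.ω * s.Ω * Real.sin (s.θ P t) * Real.cos (s.θ P t)) := by
  simp only [dΩ]
  rw [field_div, Real.sin_two_mul]
  simp only [q]
  have e : P.b * P.γ * P.f * P.μ ^ 3 / s.H ^ 2 *
      Real.sin (√(3 / 2) * s.H * s.Ω * Real.sin (s.θ P t) / (P.f * P.ω)) ^ 2 * s.H * s.Ω =
      P.b * P.γ * P.f * P.μ ^ 3 * s.Ω / s.H *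
      Real.sin (√(3 / 2) * s.H * s.Ω * Real.sin (s.θ P t) / (P.f * P.ω)) ^ 2 := by
    field_simp
  linear_combination e + 3 * P.γ * P.μ ^ 2 * s.Ω ^ 3 * s.H / P.ω ^ 2 *
    Real.sin_sq_add_cos_sq (s.θ P t)

theorem Ω_mul_dΦ (h : s.Ω ≠ 0) : s.Ω * s.dΦ P t =
    -3 * s.H * s.Ω * Real.sin (s.θ P t) * Real.cos (s.θ P t)
      + (P.ω ^ 2 - 2 * P.μ ^ 2) / P.ω * s.Ω * Real.sin (s.θ P t) ^ 2
      - P.b * P.μ ^ 3 / (√6 * s.H) * Real.sin (s.θ P t) * Real.sin (s.φ P t / P.f) := by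
  simp only [dΦ]
  rw [field_div]
  have e : s.Ω * (P.b * P.μ ^ 3 / (√6 * s.H * s.Ω)) = P.b * P.μ ^ 3 / (√6 * s.H) := by
    rw [← mul_div_assoc, mul_comm (√6 * s.H), mul_div_mul_left _ _ h]
  linear_combination -Real.sin (s.θ P t) * Real.sin (s.φ P t / P.f) * e

theorem scaleFactor_eq (hH : 0 < s.H) (hk : 0 < s.Ωk) :
    s.scaleFactor = Real.exp (-Real.log (s.Ωk * s.H ^ 2) / 2) := by
  have hpos : 0 < s.H * √s.Ωk := by positivity
  have e : s.Ωk * s.H ^ 2 = (s.H * √s.Ωk) ^ 2 := by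
    rw [mul_pow, Real.sq_sqrt hk.le, mul_comm]
  rw [scaleFactor, e, Real.log_pow, one_div]
  have : -(((2 : ℕ) : ℝ) * Real.log (s.H * √s.Ωk)) / 2 = -Real.log (s.H * √s.Ωk) := by
    push_cast; ring
  rw [this, Real.exp_neg, Real.exp_log hpos]

end FullState

open FullState in
theorem IsFullSolution.cosmicFlow {P : Params} {I : Set ℝ} {x : ℝ → FullState}
    (hx : IsFullSolution P I x) (hP : P.Admissible) :
    CosmicFlow P I (fun t => (x t).φ P t) (fun t => (x t).momentum P t) (fun t => (x t).H)
      (fun t => (x t).Ωk * (x t).H ^ 2) (fun t => (x t).Ωm P t * (x t).H ^ 2) := by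
  have hω := hP.ω_ne
  have hθ : ∀ t ∈ I, HasDerivWithinAt (fun t => (x t).θ P t) (P.ω - (x t).dΦ P t) I t :=
    fun t ht => (((hasDerivWithinAt_id t I).mul_const P.ω).fun_sub
      (hx t ht).2.2.2.1).congr_deriv (by ring)
  have dφ : ∀ t ∈ I, HasDerivWithinAt (fun t => (x t).φ P t) ((x t).momentum P t) I t := by
    intro t ht
    obtain ⟨⟨hH, hΩ, -, -⟩, d1, -, -, d4⟩ := hx t ht
    refine ((((d4.const_mul √6).fun_mul d1).fun_mul (hθ t ht).sin).div_const P.ω).congr_deriv ?_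
    have h1 := dΩ_eq (P := P) (t := t) hH.ne'
    have h2 := Ω_mul_dΦ (P := P) (t := t) hΩ.ne'
    rw [div_eq_iff hω, h1, dH, momentum]
    linear_combination -√6 * (x t).H * Real.cos ((x t).θ P t) * h2
  have dp : ∀ t ∈ I, HasDerivWithinAt (fun t => (x t).momentum P t)
      (-3 * (x t).H * (x t).momentum P t - P.force ((x t).φ P t)) I t := by
    intro t ht
    obtain ⟨⟨hH, hΩ, -, -⟩, d1, -, -, d4⟩ := hx t ht
    refine (((d4.const_mul √6).fun_mul d1).fun_mul (hθ t ht).cos).congr_deriv ?_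
    have h1 := dΩ_eq (P := P) (t := t) hH.ne'
    have h2 := Ω_mul_dΦ (P := P) (t := t) hΩ.ne'
    have hφ : (x t).φ P t = √6 * (x t).H * (x t).Ω * Real.sin ((x t).θ P t) / P.ω := rfl
    have e : √6 * (x t).H * (P.b * P.μ ^ 3 / (√6 * (x t).H)) = P.b * P.μ ^ 3 := by
      field_simp
    have e2 : (P.ω ^ 2 - 2 * P.μ ^ 2) / P.ω = P.ω - 2 * P.μ ^ 2 / P.ω := by field_simp
    rw [e2] at h1 h2
    rw [h1, dH, momentum, Params.force]
    generalize Real.sin ((x t).φ P t / P.f) = S at *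
    rw [hφ]
    have h3 := Real.sin_sq_add_cos_sq ((x t).θ P t)
    linear_combination √6 * (x t).H * Real.sin ((x t).θ P t) * h2
      + √6 * (x t).H * (-3 * (x t).H * (x t).Ω * Real.cos ((x t).θ P t)
        - P.b * P.μ ^ 3 / (√6 * (x t).H) * S
        + (P.ω - 2 * P.μ ^ 2 / P.ω) * (x t).Ω * Real.sin ((x t).θ P t)) * h3 - S * e
  have dH' : ∀ t ∈ I, HasDerivWithinAt (fun t => (x t).H)
      (-(3 * P.γ / 2 * ((x t).Ωm P t * (x t).H ^ 2) + (x t).Ωk * (x t).H ^ 2 +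
        (x t).momentum P t ^ 2 / 2)) I t := fun t ht =>
    (hx t ht).2.2.2.2.congr_deriv (by
      rw [← one_add_q_mul hP (hx t ht).1.1.ne', dH, neg_mul])
  have dK : ∀ t ∈ I, HasDerivWithinAt (fun t => (x t).Ωk * (x t).H ^ 2)
      (-2 * (x t).H * ((x t).Ωk * (x t).H ^ 2)) I t := by
    intro t ht
    obtain ⟨⟨hH, hΩ, -, -⟩, -, d2, -, d4⟩ := hx t ht
    refine (d2.fun_mul (d4.fun_pow 2)).congr_deriv ?_
    rw [dΩk_eq hH.ne', dH]
    push_cast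
    ring
  -- Conservation of the fluid is not an equation of the system; it follows by differentiating the
  -- constraint.
  have hfr : ∀ t ∈ I, (x t).Ωm P t * (x t).H ^ 2 = (x t).H ^ 2 - (x t).Ωk * (x t).H ^ 2 -
      P.energy ((x t).φ P t) ((x t).momentum P t) := fun t ht => by
    linarith [friedmann (P := P) (t := t) (hx t ht).1.1.ne']
  refine ⟨fun t ht => (hx t ht).1.1, fun t ht => ?_, fun t ht => ?_,
    fun t ht => (hx t ht).1.energy_pos hP, fun t ht => friedmann (hx t ht).1.1.ne', dφ, dp, dH', dK,
    fun t ht => ?_⟩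
  · exact mul_pos (hx t ht).1.2.2.1 (pow_pos (hx t ht).1.1 2)
  · exact mul_nonneg (hx t ht).1.2.2.2 (sq_nonneg _)
  · have de := hP.hasDerivWithinAt_energy (φ := fun t => (x t).φ P t)
      (p := fun t => (x t).momentum P t) (H := (x t).H) (dφ t ht) (dp t ht)
    have d := (((dH' t ht).fun_pow 2).fun_sub (dK t ht)).fun_sub de
    refine HasDerivWithinAt.congr_deriv (d.congr hfr (hfr t ht)) ?_
    generalize (x t).Ωm P t = m
    generalize (x t).momentum P t = p
    push_cast
    ring

/-! ### Stability and late-time limits of the full system -/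

open CosmicFlow FullState

section Full

variable {P : Params} {x : ℝ → FullState}

/-- Decay of the field relative to a dominant fluid, in terms of density fractions. -/
theorem field_sq_le {s s₀ : FullState} {t t₀ D ξ ξ₀ r : ℝ} (hP : P.Admissible) (hD : 0 < D)
    (hH : 0 < s.H) (hH₀ : 0 < s₀.H) (hξ : 0 < ξ) (hξ1 : ξ ≤ 1) (hξ₀ : 1 / 2 ≤ ξ₀) (hr : r ≤ 1)
    (hdec : P.energy (s.φ P t) (s.momentum P t) / (ξ * s.H ^ 2) ≤
      D * (P.energy (s₀.φ P t₀) (s₀.momentum P t₀) / (ξ₀ * s₀.H ^ 2)) * r) :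
    P.energy (s.φ P t) (s.momentum P t) ≤ 2 * D *
      (P.energy (s₀.φ P t₀) (s₀.momentum P t₀) / s₀.H ^ 2) * s.H ^ 2 ∧
    s.Ω ^ 2 ≤ P.ω ^ 2 * D / P.μ ^ 2 *
      (P.energy (s₀.φ P t₀) (s₀.momentum P t₀) / s₀.H ^ 2) := by
  have hμ := hP.μ_pos
  have h2 := le_energy P t s hP
  have he₀ : 0 ≤ P.energy (s₀.φ P t₀) (s₀.momentum P t₀) := by
    linarith [hP.kinetic_le (s₀.φ P t₀) (s₀.momentum P t₀), sq_nonneg (s₀.momentum P t₀)]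
  set e := P.energy (s.φ P t) (s.momentum P t)
  set e₀ := P.energy (s₀.φ P t₀) (s₀.momentum P t₀)
  have hξ₀' : 0 < ξ₀ := by linarith
  have h1 : e ≤ 2 * D * (e₀ / s₀.H ^ 2) * s.H ^ 2 := by
    have hr' : D * (e₀ / (ξ₀ * s₀.H ^ 2)) * r ≤ D * (e₀ / (1 / 2 * s₀.H ^ 2)) * 1 :=
      (mul_le_mul_of_nonneg_left hr (by positivity)).trans (by gcongr)
    have := (div_le_iff₀ (by positivity)).1 (hdec.trans hr')
    calc e ≤ D * (e₀ / (1 / 2 * s₀.H ^ 2)) * 1 * (ξ * s.H ^ 2) := this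
      _ ≤ D * (e₀ / (1 / 2 * s₀.H ^ 2)) * 1 * (1 * s.H ^ 2) := by gcongr
      _ = _ := by field_simp
  refine ⟨h1, ?_⟩
  have h3 : 2 * P.μ ^ 2 * (s.Ω ^ 2 * s.H ^ 2) ≤
      P.ω ^ 2 * (2 * D * (e₀ / s₀.H ^ 2) * s.H ^ 2) :=
    h2.trans (mul_le_mul_of_nonneg_left h1 (sq_nonneg _))
  have h4 : P.μ ^ 2 * s.Ω ^ 2 ≤ P.ω ^ 2 * D * (e₀ / s₀.H ^ 2) := by
    refine le_of_mul_le_mul_right ?_ (by positivity : 0 < 2 * s.H ^ 2)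
    linarith
  rw [div_mul_eq_mul_div, le_div_iff₀ (by positivity)]
  linarith

theorem FullState.Physical.fractions {s : FullState} {t : ℝ} (h : s.Physical P t)
    (hP : P.Admissible) : ∃ E, 0 < E ∧ E ≤ s.Ω ^ 2 ∧ s.Ωk + s.Ωm P t + E = 1 ∧
      E = P.energy (s.φ P t) (s.momentum P t) / s.H ^ 2 := by
  have hH := h.1
  have he := h.energy_pos hP
  refine ⟨_, by positivity, ?_, ?_, rfl⟩
  · rw [div_le_iff₀ (by positivity)]
    exact energy_le P t s hP
  · have := friedmann (P := P) (t := t) hH.ne'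
    field_simp
    linarith

theorem fullStable_matter (hP : P.Admissible) (hγ : P.γ ≤ 2 / 3) {h D : ℝ}
    (hD : 0 < D) (hdec : FieldDecays P h D) : FullStable P h F₀ := by
  intro ε hε
  have hμ := hP.μ_pos
  have hω := hP.ω_ne
  set Q := P.ω ^ 2 * D / P.μ ^ 2 with hQ
  have hQpos : 0 < Q := by positivity
  -- Again `1 / 4` keeps the matter fraction above `1 / 2`. The bound `Ω² ≤ Q E₀ ≤ Q Ω₀²` explains
  -- `ε / (Q + 1)`.
  refine ⟨min (1 / 4) (min (ε / 2) (ε / (Q + 1))), by positivity,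
    fun t₀ t₁ x hx hH hd t ht => ?_⟩
  have hs : t₀ ∈ Icc t₀ t₁ := ⟨le_rfl, ht.1.trans ht.2⟩
  have hI : Convex ℝ (Icc t₀ t₁) := convex_Icc t₀ t₁
  have F := hx.cosmicFlow hP
  have p0 := (hx t₀ hs).1
  have p1 := (hx t ht).1
  obtain ⟨E₀, hE₀, hE₀', hsum₀, hE₀eq⟩ := p0.fractions hP
  obtain ⟨E, hE, hE', hsum, hEeq⟩ := p1.fractions hP
  obtain ⟨hH0, hΩ0, hk0, -⟩ := p0
  obtain ⟨hH1, hΩ1, hk1, -⟩ := p1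
  simp only [FullState.point, F₀, dist_zero_lt_iff, sub_zero, lt_min_iff] at hd ⊢
  rw [abs_of_pos hΩ0, abs_of_pos hk0] at hd
  rw [abs_of_pos hΩ1, abs_of_pos hk1]
  obtain ⟨⟨a1, b1⟩, ⟨a2, b2⟩, a3, b3⟩ := hd
  have hm0 : 1 / 2 ≤ (x t₀).Ωm P t₀ := by nlinarith
  have hdil : ∀ s ∈ Icc t₀ t₁, _ := fun s hs' => F.dilution hI F.deriv_M hs hs'
  have hMpos : ∀ s ∈ Icc t₀ t₁, 0 < (x s).Ωm P s * (x s).H ^ 2 := fun s hs' => by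
    rw [hdil s hs']
    have : 0 < (x t₀).Ωm P t₀ := by linarith
    positivity
  have hm1 : 0 < (x t).Ωm P t := pos_of_mul_pos_left (hMpos t ht) (sq_nonneg _)
  have hN := sub_nonneg.2 (F.efolds_monotoneOn hI hs ht ht.1)
  have hf := (field_sq_le hP hD hH1 hH0 hm1 (by linarith) hm0 (Real.exp_le_one_iff.2 (by linarith))
    (hdec _ _ _ _ _ _ F hI t₀ ⟨hs, fun s hs' => hs'.1⟩ hH _ _ hγ hMpos F.deriv_M t ht)).2
  rw [← hE₀eq, ← hQ] at hf
  constructor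
  · refine lt_of_pow_lt_pow_left₀ 2 hε.le ?_
    have h1 : (x t₀).Ω ^ 2 < (ε / (Q + 1)) ^ 2 := by gcongr
    calc (x t).Ω ^ 2 ≤ Q * E₀ := hf
      _ < Q * (ε / (Q + 1)) ^ 2 := by gcongr; linarith
      _ ≤ (Q + 1) ^ 2 * (ε / (Q + 1)) ^ 2 := by gcongr; nlinarith
      _ = ε ^ 2 := by field_simp
  · have := fraction_le hH1 hH0 (by linarith : 3 * P.γ ≤ 2) hN (hdil t ht)
      (F.dilution hI F.deriv_K hs ht) (by linarith) (by linarith) hk0.le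
    nlinarith

theorem fullStable_milne (hP : P.Admissible) (hγ : 2 / 3 < P.γ) {h D : ℝ}
    (hD : 0 < D) (hdec : FieldDecays P h D) : FullStable P h C := by
  intro ε hε
  have hμ := hP.μ_pos
  have hω := hP.ω_ne
  set Q := P.ω ^ 2 * D / P.μ ^ 2 with hQ
  have hQpos : 0 < Q := by positivity
  -- With `Ωk ≥ 1 / 2` initially, matter grows at most by the factor `2` and field energy by `2 D`,
  -- so `1 - Ωk` grows at most by `2 (1 + D)`. As `E₀ ≤ 1 - Ωk`, the bound `Ω² ≤ Q E₀` requires `ε ^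
  -- 2 / Q`.
  refine ⟨min (1 / 2) (min (ε / (2 * (1 + D))) (ε ^ 2 / Q)), by positivity,
    fun t₀ t₁ x hx hH hd t ht => ?_⟩
  have hs : t₀ ∈ Icc t₀ t₁ := ⟨le_rfl, ht.1.trans ht.2⟩
  have hI : Convex ℝ (Icc t₀ t₁) := convex_Icc t₀ t₁
  have F := hx.cosmicFlow hP
  have p0 := (hx t₀ hs).1
  have p1 := (hx t ht).1
  obtain ⟨E₀, hE₀, hE₀', hsum₀, hE₀eq⟩ := p0.fractions hP
  obtain ⟨E, hE, hE', hsum, hEeq⟩ := p1.fractions hP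
  obtain ⟨hH0, hΩ0, hk0, hm0⟩ := p0
  obtain ⟨hH1, hΩ1, hk1, hm1⟩ := p1
  simp only [FullState.point, C, dist_zero_lt_iff, lt_min_iff] at hd ⊢
  obtain ⟨⟨-, b1⟩, ⟨-, b2⟩, -, b3⟩ := hd
  rw [abs_sub_comm, abs_of_pos (by linarith : 0 < 1 - (x t₀).Ωk)] at b1 b2 b3
  rw [abs_sub_comm _ (1 : ℝ), abs_of_pos (by linarith : 0 < 1 - (x t).Ωk), abs_of_pos hΩ1]
  have hN := sub_nonneg.2 (F.efolds_monotoneOn hI hs ht ht.1)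
  obtain ⟨hf1, hf⟩ := field_sq_le hP hD hH1 hH0 hk1 (by linarith)
    (by linarith : 1 / 2 ≤ (x t₀).Ωk) (Real.exp_le_one_iff.2 (by linarith))
    (hdec _ _ _ _ _ _ F hI t₀ ⟨hs, fun s hs' => hs'.1⟩ hH _ (2 / 3) le_rfl F.K_pos
      (fun s hs' => (F.deriv_K s hs').congr_deriv (by ring)) t ht)
  rw [← hE₀eq, ← hQ] at hf
  rw [← hE₀eq, ← div_le_iff₀ (by positivity), ← hEeq] at hf1
  constructor
  · refine lt_of_pow_lt_pow_left₀ 2 hε.le ?_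
    calc (x t).Ω ^ 2 ≤ Q * E₀ := hf
      _ < Q * (ε ^ 2 / Q) := by gcongr; linarith
      _ = ε ^ 2 := by field_simp
  · have h1 := fraction_le hH1 hH0 (by linarith : 2 ≤ 3 * P.γ) hN
      (F.dilution hI F.deriv_K hs ht) (F.dilution hI F.deriv_M hs ht) (by linarith) hk0.le hm0
    rw [lt_div_iff₀ (by positivity)] at b2
    nlinarith

/-- The e-folds diverge, so `FieldDecays` forces `e / X → 0` and only curvature and matter enter the
limit. Comparability of `Ω²` with the energy fraction carries the result back to `Ω`. -/
theorem fullLateTime_of_flow {t₀ : ℝ} (hx : IsFullSolution P (Ici t₀) x) (hP : P.Admissible)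
    (hγ : 0 < P.γ) (hγ2 : P.γ < 2) {h D : ℝ} (hdec : FieldDecays P h D) (hH : (x t₀).H ≤ h)
    {X : ℝ → ℝ} {g k m : ℝ} (hg : 0 < g) (hg' : g ≤ 2 / 3)
    (hX : ∀ t ∈ Ici t₀, 0 < X t)
    (hX' : ∀ t ∈ Ici t₀, HasDerivWithinAt X (-(3 * g) * (x t).H * X t) (Ici t₀) t)
    (hK : Tendsto (fun t => (x t).Ωk * (x t).H ^ 2 / X t) atTop (𝓝 k))
    (hM : Tendsto (fun t => (x t).Ωm P t * (x t).H ^ 2 / X t) atTop (𝓝 m))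
    (hkm : 0 < k + m) (hq : 3 * P.γ * m + 2 * k = 3 * g * (k + m)) :
    FullLateTime P x (0, k / (k + m)) (3 * g / 2 - 1) (matterScale g) := by
  have hI : Convex ℝ (Ici t₀) := convex_Ici t₀
  have h0 : t₀ ∈ Ici t₀ := mem_Ici.2 le_rfl
  have hev : ∀ᶠ t in atTop, t ∈ Ici t₀ := eventually_ge_atTop t₀
  have F := hx.cosmicFlow hP
  have hμ := hP.μ_pos
  have hN := F.efolds_tendsto hP hγ hγ2
  set K : ℝ → ℝ := fun t => (x t).Ωk * (x t).H ^ 2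
  have hE : Tendsto (fun t => P.energy ((x t).φ P t) ((x t).momentum P t) / X t) atTop (𝓝 0) := by
    have hlim : Tendsto (fun t => D * (P.energy ((x t₀).φ P t₀) ((x t₀).momentum P t₀) / X t₀) *
        Real.exp (-((efolds K t - efolds K t₀) / 2))) atTop (𝓝 0) := by
      have := (Real.tendsto_exp_neg_atTop_nhds_zero.comp
        ((tendsto_atTop_add_const_right _ (-efolds K t₀) hN).atTop_div_const
          (by norm_num : (0 : ℝ) < 2))).const_mul
        (D * (P.energy ((x t₀).φ P t₀) ((x t₀).momentum P t₀) / X t₀))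
      rwa [mul_zero] at this
    refine squeeze_zero' ?_ ?_ hlim
    · filter_upwards [hev] with t ht using (div_pos (F.energy_pos t ht) (hX t ht)).le
    · filter_upwards [hev] with t ht
      exact hdec _ _ _ _ _ _ F hI t₀ ⟨h0, fun s hs => hs⟩ hH X g hg' hX hX' t ht
  obtain ⟨lK, lE, lH, lr, lTH, a₀, ha₀, H₀, hH₀, lS⟩ :=
    F.lateTime hP hg hX hX' hE hK hM hkm hq
  refine ⟨?_, lH, ?_, ?_, a₀, ha₀, H₀, hH₀, ?_⟩
  · refine Tendsto.prodMk_nhds ?_ (lK.congr' ?_)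
    · have hsq : Tendsto (fun t => (x t).Ω ^ 2) atTop (𝓝 0) := by
        refine squeeze_zero' (.of_forall fun t => sq_nonneg _) ?_
          (by simpa using lE.const_mul (P.ω ^ 2 / (2 * P.μ ^ 2)))
        filter_upwards [hev] with t ht
        have hHt := F.H_pos t ht
        have := le_energy P t (x t) hP
        rw [div_mul_div_comm, le_div_iff₀ (by positivity)]
        linarith
      have := (Real.continuous_sqrt.tendsto _).comp hsq
      rw [Real.sqrt_zero] at this
      refine this.congr' ?_
      filter_upwards [hev] with t ht using Real.sqrt_sq (hx t ht).1.2.1.le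
    · filter_upwards [hev] with t ht
      exact mul_div_cancel_right₀ _ (pow_ne_zero 2 (F.H_pos t ht).ne')
  · refine (lr.sub_const 1).congr' ?_
    filter_upwards [hev] with t ht
    have hHt := (F.H_pos t ht).ne'
    rw [← one_add_q_mul hP hHt, mul_div_cancel_right₀ _ (pow_ne_zero 2 hHt)]
    ring
  · exact lTH.trans (le_of_eq (by congr 1; field_simp; ring))
  · refine lS.congr' ?_
    filter_upwards [hev] with t ht
    rw [scaleFactor_eq (F.H_pos t ht) (hx t ht).1.2.2.1]
    rfl

theorem tendsto_diluted_ratio {N X Y : ℝ → ℝ} {k l t₀ : ℝ} (hkl : k < l)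
    (hN : Tendsto N atTop atTop)
    (hX : ∀ t ∈ Ici t₀, X t = X t₀ * Real.exp (-k * (N t - N t₀)))
    (hY : ∀ t ∈ Ici t₀, Y t = Y t₀ * Real.exp (-l * (N t - N t₀))) :
    Tendsto (fun t => Y t / X t) atTop (𝓝 0) := by
  have h := (Real.tendsto_exp_neg_atTop_nhds_zero.comp
    ((tendsto_atTop_add_const_right _ (-N t₀) hN).const_mul_atTop (sub_pos.2 hkl))).const_mul
      (Y t₀ / X t₀)
  rw [mul_zero] at h
  refine h.congr' ?_
  filter_upwards [eventually_ge_atTop t₀] with t ht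
  have e : Real.exp (-l * (N t - N t₀)) =
      Real.exp (-((l - k) * (N t + -N t₀))) * Real.exp (-k * (N t - N t₀)) := by
    rw [← Real.exp_add]; congr 1; ring
  simp only [Function.comp]
  rw [hY t ht, hX t ht, e, ← mul_assoc, mul_div_mul_right _ _ (Real.exp_pos _).ne']
  ring

theorem fullLateTime_matter {t₀ : ℝ} (hx : IsFullSolution P (Ici t₀) x) (hP : P.Admissible)
    (hγ : 0 < P.γ) (hγ' : P.γ < 2 / 3) {h D : ℝ} (hdec : FieldDecays P h D)
    (hH : (x t₀).H ≤ h) (hm : 0 < (x t₀).Ωm P t₀) :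
    FullLateTime P x F₀ ((3 * P.γ - 2) / 2) (matterScale P.γ) := by
  have hI : Convex ℝ (Ici t₀) := convex_Ici t₀
  have h0 : t₀ ∈ Ici t₀ := mem_Ici.2 le_rfl
  have F := hx.cosmicFlow hP
  have hH0 := F.H_pos t₀ h0
  have hMpos : ∀ s ∈ Ici t₀, 0 < (x s).Ωm P s * (x s).H ^ 2 := fun s hs' => by
    rw [F.dilution hI F.deriv_M h0 hs']
    positivity
  have := fullLateTime_of_flow hx hP hγ (by linarith) hdec hH hγ hγ'.le hMpos F.deriv_M (k := 0)
    (m := 1)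
    (tendsto_diluted_ratio (by linarith : 3 * P.γ < 2) (F.efolds_tendsto hP hγ (by linarith))
      (fun t ht => F.dilution hI F.deriv_M h0 ht) fun t ht => F.dilution hI F.deriv_K h0 ht)
    (tendsto_const_nhds.congr' (by
      filter_upwards [eventually_ge_atTop t₀] with t ht using (div_self (hMpos t ht).ne').symm))
    (by norm_num) (by ring)
  rw [zero_div] at this
  convert this using 1
  · rfl
  · ring

theorem fullLateTime_milne {t₀ : ℝ} (hx : IsFullSolution P (Ici t₀) x) (hP : P.Admissible)
    (hγ : 2 / 3 < P.γ) (hγ2 : P.γ < 2) {h D : ℝ} (hdec : FieldDecays P h D)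
    (hH : (x t₀).H ≤ h) : FullLateTime P x C 0 milneScale := by
  have hI : Convex ℝ (Ici t₀) := convex_Ici t₀
  have h0 : t₀ ∈ Ici t₀ := mem_Ici.2 le_rfl
  have F := hx.cosmicFlow hP
  have := fullLateTime_of_flow hx hP (by linarith) hγ2 hdec hH (g := 2 / 3) (by norm_num) le_rfl
    F.K_pos (fun s hs' => (F.deriv_K s hs').congr_deriv (by ring)) (k := 1) (m := 0)
    (tendsto_const_nhds.congr' (by
      filter_upwards [eventually_ge_atTop t₀] with t ht using (div_self (F.K_pos t ht).ne').symm))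
    (tendsto_diluted_ratio (by linarith : 2 < 3 * P.γ)
      (F.efolds_tendsto hP (by linarith) hγ2)
      (fun t ht => F.dilution hI F.deriv_K h0 ht) fun t ht => F.dilution hI F.deriv_M h0 ht)
    (by norm_num) (by ring)
  rw [milneScale_eq]
  convert this using 1
  · simp [C]
  · norm_num

/-- Matter and curvature dilute alike, so their ratio is constant. Curvature serves as the dominant
component because it is positive even if matter is absent. -/
theorem fullLateTime_critical {t₀ : ℝ} (hx : IsFullSolution P (Ici t₀) x) (hP : P.Admissible)
    (hγ : P.γ = 2 / 3) {h D : ℝ} (hdec : FieldDecays P h D) (hH : (x t₀).H ≤ h) :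
    FullLateTime P x (0, (x t₀).Ωk / ((x t₀).Ωk + (x t₀).Ωm P t₀)) 0 (matterScale P.γ) := by
  have hI : Convex ℝ (Ici t₀) := convex_Ici t₀
  have h0 : t₀ ∈ Ici t₀ := mem_Ici.2 le_rfl
  have F := hx.cosmicFlow hP
  obtain ⟨hH0, -, hk0, hm0⟩ := (hx t₀ h0).1
  have := fullLateTime_of_flow hx hP (by linarith) (by linarith) hdec hH (g := P.γ) (by linarith)
    hγ.le F.K_pos (fun s hs' => (F.deriv_K s hs').congr_deriv (by rw [hγ]; ring)) (k := 1)
    (m := (x t₀).Ωm P t₀ / (x t₀).Ωk)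
    (tendsto_const_nhds.congr' (by
      filter_upwards [eventually_ge_atTop t₀] with t ht using (div_self (F.K_pos t ht).ne').symm))
    (tendsto_const_nhds.congr' (by
      filter_upwards [eventually_ge_atTop t₀] with t ht
      have e : -(3 * P.γ) = -2 := by rw [hγ]; norm_num
      rw [F.dilution hI F.deriv_M h0 ht, F.dilution hI F.deriv_K h0 ht, e,
        mul_div_mul_right _ _ (Real.exp_pos _).ne', mul_div_mul_right _ _ (pow_pos hH0 2).ne']))
    (by positivity) (by rw [hγ]; ring)
  convert this using 1
  · field_simp
  · rw [hγ]; norm_num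

end Full

end OpenFLRW

open OpenFLRW in
theorem theorem4 (P : Params) (hb : 0 < P.b) (hμ : 0 < P.μ) (hω : 2 * P.μ ^ 2 < P.ω ^ 2) :
    -- (i) the matter dominated point, below and at the critical index
    (0 < P.γ → P.γ ≤ 2 / 3 →
      RestsWithScale P F₀ (matterScale P.γ) ∧
      AvgStable P F₀ ∧
      (P.γ < 2 / 3 → ∀ (τ₀ : ℝ) (y : ℝ → AvgState), IsAvgSolution P (Ici τ₀) y →
        0 < (y τ₀).Ωm →
        AvgLateTime P y F₀ ((3 * P.γ - 2) / 2) (matterScale P.γ)) ∧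
      (P.γ = 2 / 3 → ∀ (τ₀ : ℝ) (y : ℝ → AvgState), IsAvgSolution P (Ici τ₀) y →
        0 < (y τ₀).Ωk + (y τ₀).Ωm →
        AvgLateTime P y (0, (y τ₀).Ωk / ((y τ₀).Ωk + (y τ₀).Ωm)) 0 (matterScale P.γ)) ∧
      ∃ h > 0, FullStable P h F₀ ∧
        (P.γ < 2 / 3 → ∀ (t₀ : ℝ) (x : ℝ → FullState), IsFullSolution P (Ici t₀) x →
          (x t₀).H ≤ h → 0 < (x t₀).Ωm P t₀ →
          FullLateTime P x F₀ ((3 * P.γ - 2) / 2) (matterScale P.γ)) ∧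
        (P.γ = 2 / 3 → ∀ (t₀ : ℝ) (x : ℝ → FullState), IsFullSolution P (Ici t₀) x →
          (x t₀).H ≤ h →
          FullLateTime P x (0, (x t₀).Ωk / ((x t₀).Ωk + (x t₀).Ωm P t₀)) 0
            (matterScale P.γ))) ∧
    -- the de Sitter limit of the matter dominated line element
    (∀ H₀ t : ℝ, 0 < H₀ →
      Tendsto (fun g => matterScale g H₀ t) (𝓝[>] 0) (𝓝 (Real.exp (H₀ * t)))) ∧
    -- (ii) the Milne point
    (2 / 3 < P.γ → P.γ < 2 →
      RestsWithScale P C milneScale ∧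
      AvgStable P C ∧
      (∀ (τ₀ : ℝ) (y : ℝ → AvgState), IsAvgSolution P (Ici τ₀) y →
        0 < (y τ₀).Ωk → AvgLateTime P y C 0 milneScale) ∧
      ∃ h > 0, FullStable P h C ∧
        ∀ (t₀ : ℝ) (x : ℝ → FullState), IsFullSolution P (Ici t₀) x →
          (x t₀).H ≤ h → FullLateTime P x C 0 milneScale) := by
  have hP : P.Admissible := ⟨hb, hμ, hω⟩
  refine ⟨fun hγ hγ' => ⟨?_, avgStable_matter hγ', fun h τ₀ y hy hm => avgLateTime_matter hy hγ h hm,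
    fun h τ₀ y hy hkm => avgLateTime_critical hy h hkm, ?_⟩,
    fun H₀ t _ => tendsto_matterScale_zero H₀ t,
    fun hγ hγ' => ⟨?_, avgStable_milne hγ, fun τ₀ y hy hk => avgLateTime_milne hy hγ hk, ?_⟩⟩
  · exact restsWithScale hγ le_rfl zero_le_one (by ring) (by ring)
  · obtain ⟨h, hh, D, hD, hdec⟩ := CosmicFlow.exists_fieldDecays hP hγ (by linarith)
    exact ⟨h, hh, fullStable_matter hP hγ' hD hdec,
      fun hc t₀ x hx hH hm => fullLateTime_matter hx hP hγ hc hdec hH hm,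
      fun hc t₀ x hx hH => fullLateTime_critical hx hP hc hdec hH⟩
  · rw [milneScale_eq]
    exact restsWithScale (by norm_num) zero_le_one le_rfl (by ring) (by ring)
  · obtain ⟨h, hh, D, hD, hdec⟩ := CosmicFlow.exists_fieldDecays hP (by linarith) hγ'
    exact ⟨h, hh, fullStable_milne hP hγ hD hdec,
      fun t₀ x hx hH => fullLateTime_milne hx hP hγ hγ' hdec hH⟩
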